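/- For an integer $t\ge -1$ let $f_t(x)=x^3-tx^2-(t+3)x-1$, let $\theta_t$ be a root of $f_t$, put $K_t=\mathbb Q(\theta_t)$ (a cyclic cubic field) and $\Delta_t=t^2+3t+9$. Let $K=K_t$ for some $t\ge -1$, let $\sigma$ be a generator of $G=\mathrm{Gal}(K/\mathbb Q)$, and let $c_K$ be the conductor of $K$, i.e. the least $n\ge 1$ such that $K\subset\mathbb Q(\zeta_n)$. There is a unique integral ideal $\mathfrak C_K$ of $\mathcal O_K$ with $N\mathfrak C_K=c_K$. Let $I_K^G$ be the group of $G$-invariant nonzero fractional ideals of $K$, let $P_K^G\subset I_K^G$ be the subgroup of principal ones, and let $P_{\mathbb Q}\subset P_K^G$ be the subgroup of ideals $a\mathcal O_K$ with $a\in\mathbb Q^\times$; write $\overline{\mathfrak A}$ for the class of $\mathfrak A\in I_K^G$ in $I_K^G/P_{\mathbb Q}\supset P_K^G/P_{\mathbb Q}$. Then $\mathfrak C_K\in I_K^G$ and $(\theta_t-\sigma(\theta_t))\in P_K^G$. Assume that $K\ne\mathbb Q(\zeta_9+\zeta_9^{-1})$. Then the following are equivalent: (i) $\mathfrak C_K$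 is principal; (ii) $\overline{\mathfrak C_K}=\overline{(\theta_t-\sigma(\theta_t))}$ or $\overline{\mathfrak C_K}=\overline{(\theta_t-\sigma(\theta_t))^2}$ (equalities with elements of $P_K^G/P_{\mathbb Q}$); (iii) $\frac{\Delta_t}{c_K}$ or $\frac{\Delta_t^2}{c_K}$ is the cube of a natural number. Moreover, (i) does not involve $t$, and the truth of (ii) and of (iii) does not depend on the choice of $t\geq -1$ with $K=K_t$ (nor, for (ii), on the choices of $\theta_t$ and $\sigma$). For the excluded field $K=\mathbb Q(\zeta_9+\zeta_9^{-1})$ the ideal $\mathfrak C_K$ is principal: $\mathfrak C_K=(\zeta_9+\zeta_9^{-1}+1)^2$. -/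

import Mathlib

open scoped nonZeroDivisors NumberField

namespace SimplestCubic

noncomputable section

/-- The Shanks cubic `f_t(x) = x³ - t x² - (t + 3) x - 1`. -/
def shanksPoly (t : ℤ) : Polynomial ℤ :=
  Polynomial.X ^ 3 - Polynomial.C t * Polynomial.X ^ 2 - Polynomial.C (t + 3) * Polynomial.X - 1

/-- `Δ_t = t² + 3 t + 9`. -/
def shanksDelta (t : ℤ) : ℤ := t ^ 2 + 3 * t + 9

/-- `K = ℚ(θ)` where `θ` is a root of `f_t`, with `t ≥ -1`; that is, `K = K_t` and `θ = θ_t`. -/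
structure IsSimplestCubic (K : Type*) [Field K] [NumberField K] (t : ℤ) (θ : K) : Prop where
  neg_one_le : -1 ≤ t
  root : Polynomial.aeval θ (shanksPoly t) = 0
  adjoin_eq_top : IntermediateField.adjoin ℚ {θ} = ⊤

/-- `ζ₉ = exp(2πi/9)`. -/
def zetaNine : ℂ := Complex.exp (2 * Real.pi * Complex.I / 9)

/-- The field `ℚ(ζ₉ + ζ₉⁻¹)`. -/
abbrev NinthField : IntermediateField ℚ ℂ :=
  IntermediateField.adjoin ℚ {zetaNine + zetaNine⁻¹}

theorem isIntegral_zetaNine_add_inv : IsIntegral ℚ (zetaNine + zetaNine⁻¹) := by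
  have h : zetaNine ^ 9 = 1 := (Complex.isPrimitiveRoot_exp 9 (by norm_num)).pow_eq_one
  have h1 : IsIntegral ℚ zetaNine := IsIntegral.of_pow (n := 9) (by norm_num) (h ▸ isIntegral_one)
  exact h1.add h1.inv

instance : NumberField NinthField where
  to_finiteDimensional := by
    have := IntermediateField.adjoin.finiteDimensional isIntegral_zetaNine_add_inv
    convert this

variable (K : Type*) [Field K] [NumberField K]

/-- The conductor of an abelian field `K`: the least `n ≥ 1` such that `K` embeds in `ℚ(ζ_n)`. -/
def fieldConductor : ℕ := sInf {n : ℕ | 0 < n ∧ Nonempty (K →+* CyclotomicField n ℚ)}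

/-- The ideal `ℭ_K`: the integral ideal whose norm is the conductor. (It is meant for fields in
which there is exactly one such ideal; an arbitrary ideal if there is none.) -/
def conductorIdeal : Ideal (𝓞 K) :=
  Classical.epsilon fun C : Ideal (𝓞 K) => Ideal.absNorm C = fieldConductor K

variable {K} in
/-- The action of a field automorphism on fractional ideals, `𝔄 ↦ σ(𝔄)`. -/
def galMap (σ : K ≃ₐ[ℚ] K) : FractionalIdeal (𝓞 K)⁰ K ≃+* FractionalIdeal (𝓞 K)⁰ K :=
  FractionalIdeal.ringEquivOfRingEquiv K K
    (NumberField.RingOfIntegers.mapRingEquiv (σ : K ≃+* K))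

/-- `I_K^G`, the group of ambiguous (that is, Galois invariant) fractional ideals, as a subgroup
of the group `I_K` of all nonzero fractional ideals. -/
def ambiguousIdeals : Subgroup (FractionalIdeal (𝓞 K)⁰ K)ˣ where
  carrier := {A | ∀ σ : K ≃ₐ[ℚ] K, Units.mapEquiv (galMap σ).toMulEquiv A = A}
  one_mem' := fun σ => map_one _
  mul_mem' := fun {A B} hA hB σ => by rw [map_mul, hA σ, hB σ]
  inv_mem' := fun {A} hA σ => by rw [map_inv, hA σ]

/-- `P_K^G = I_K^G ∩ P_K`, the group of principal ambiguous ideals, inside `I_K^G`. -/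
def principalAmbiguousIdeals : Subgroup (ambiguousIdeals K) :=
  (toPrincipalIdeal (𝓞 K) K).range.subgroupOf (ambiguousIdeals K)

/-- `P_ℚ`, the group of the ideals `a 𝓞 K` with `a ∈ ℚˣ`, inside `I_K^G`. -/
def rationalIdeals : Subgroup (ambiguousIdeals K) :=
  ((toPrincipalIdeal (𝓞 K) K).comp (Units.map (algebraMap ℚ K).toMonoidHom)).range.subgroupOf
    (ambiguousIdeals K)

/-- `I_K^G / P_ℚ`. -/
abbrev AmbiguousClassGroup : Type _ := ambiguousIdeals K ⧸ rationalIdeals K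

/-- `P_K^G / P_ℚ`, as a subgroup of `I_K^G / P_ℚ`. -/
def principalAmbiguousClasses : Subgroup (AmbiguousClassGroup K) :=
  (principalAmbiguousIdeals K).map (QuotientGroup.mk' (rationalIdeals K))

variable {K}

/-- `x` is the class in `I_K^G / P_ℚ` of the fractional ideal `A`; in particular `A` is nonzero
and ambiguous. -/
def IsClassOf (x : AmbiguousClassGroup K) (A : FractionalIdeal (𝓞 K)⁰ K) : Prop :=
  ∃ a : ambiguousIdeals K,
    ((a : (FractionalIdeal (𝓞 K)⁰ K)ˣ) : FractionalIdeal (𝓞 K)⁰ K) = A ∧ QuotientGroup.mk a = x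

/-- The class of `ℭ_K` equals the class of `(θ - σ θ)` or of `(θ - σ θ)²`. -/
def ClassCondition (θ : K) (σ : K ≃ₐ[ℚ] K) : Prop :=
  ∃ x y : AmbiguousClassGroup K,
    IsClassOf x (conductorIdeal K : FractionalIdeal (𝓞 K)⁰ K) ∧
    IsClassOf y (FractionalIdeal.spanSingleton (𝓞 K)⁰ (θ - σ θ)) ∧
    (x = y ∨ x = y ^ 2)

variable (K)

/-- `Δ_t / c_K` or `Δ_t² / c_K` is the cube of a natural number. -/
def CubeCondition (t : ℤ) : Prop :=
  (∃ n : ℕ, (shanksDelta t : ℚ) / fieldConductor K = (n : ℚ) ^ 3) ∨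
  (∃ n : ℕ, (shanksDelta t : ℚ) ^ 2 / fieldConductor K = (n : ℚ) ^ 3)

end

end SimplestCubic

open SimplestCubic

/-! Two ideals have cubes generated by rational integers. With δ = θ - σθ, the square of N(δ) is the
discriminant of `f_t`, namely `Δ_t²`, and δ differs from its conjugates by units, so (δ)³ = (`Δ_t`).
Every prime dividing c = `c_K` is totally ramified, so ℭ³ = (c). Since cubing is injective on
ideals, ℭ = q(δ)^i with q rational holds exactly when `Δ_t^i / c` is a rational cube up to sign, and
this cube is that of a natural number because c is cube-free. This is (ii) ⇔ (iii); (ii) ⇒ (i) is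
clear.

For (i) ⇒ (ii), a generator α of an ambiguous ideal satisfies σα = wα with a unit w of norm 1, and
the class of (α) modulo rational ideals is determined by w modulo the quotients σe/e. On the group
of norm-one units (σ - 1)² = -3σ, and this group has at most two generators, so σ - 1 has image of
index at most 3. Hence the class of δ, once nontrivial, generates all principal classes. If it is
trivial, `Δ_t` is a cube, which forces c = 9 and K = ℚ(ζ₉ + ζ₉⁻¹). The class of ℭ is itself
nontrivial since c > 1 is cube-free.

All of this needs c explicitly: it is the product of the primes p ≠ 3 whose exponent in `Δ_t` is
prime to 3, times 9 if 3 ∣ t and t ≢ 12 mod 27 (`fieldConductor_eq`). These primes must divide c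
because they ramify in K and ℚ(ζ_n) is unramified outside n. That they suffice is shown by Cardano's
formula: with π = t - 3ω and ππ̄ = `Δ_t`, the roots of `f_t` need only a cube root of π²π̄ (besides
ω). Factoring π into primary primes J of norm p, each J is a Jacobi sum and J²J̄ = pJ is up to sign
the cube of a Gauss sum, so its cube root lies in ℚ(ω, ζ_p) (`isCubicNorm_kummerElt`). -/

namespace SimplestCubic

/-! ### Cubic norms, Jacobi sums and Gauss sums -/

/-- Cubes in a field `L` of the elements `x² c(x)`, a condition multiplicative in `x`. -/
def IsCubicNorm {O L : Type*} [CommRing O] [Field L] (c : O →+* O) (f : O →+* L) (x : O) : Prop :=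
  ∃ y : L, y ^ 3 = f (x ^ 2 * c x)

namespace IsCubicNorm

variable {O L : Type*} [CommRing O] [Field L] {c : O →+* O} {f : O →+* L} {x y : O}

theorem one : IsCubicNorm c f 1 := ⟨1, by simp⟩

theorem neg_one : IsCubicNorm c f (-1) := ⟨-1, by simp; norm_num⟩

theorem mul (hx : IsCubicNorm c f x) (hy : IsCubicNorm c f y) : IsCubicNorm c f (x * y) := by
  obtain ⟨a, ha⟩ := hx
  obtain ⟨b, hb⟩ := hy
  exact ⟨a * b, by rw [mul_pow, ha, hb, ← map_mul, map_mul c]; ring_nf⟩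

theorem neg (hx : IsCubicNorm c f x) : IsCubicNorm c f (-x) := by
  simpa using neg_one.mul hx

theorem cube (x : O) : IsCubicNorm c f (x ^ 3) :=
  ⟨f (x ^ 2 * c x), by simp only [map_mul, map_pow]; ring⟩

theorem pow (hx : IsCubicNorm c f x) (n : ℕ) : IsCubicNorm c f (x ^ n) := by
  induction n with
  | zero => simpa using one
  | succ n ih => rw [pow_succ]; exact ih.mul hx

end IsCubicNorm

/-- For a cubic character χ mod p take J = J(χ, χ) and J' = J(χ⁻¹, χ⁻¹). The Gauss sum satisfies
g(χ)³ = χ(-1) p J, and pJ = J²J', so J²J' becomes a cube as soon as the p-th roots of unity are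
available. -/
theorem MulChar.exists_cubic_jacobiSum {O L : Type*} [CommRing O] [IsDomain O] [CharZero O]
    [Field L] [CharZero L] {c : O →+* O} {f : O →+* L} (hf : Function.Injective f) {η : O}
    (hη : IsPrimitiveRoot η 3) (hc : c η = η ^ 2) {p : ℕ} [Fact p.Prime] (hp : 3 ∣ p - 1) :
    ∃ J J' : O, J * J' = p ∧ c J = J' ∧ c J' = J ∧ (3 : O) ∣ J + 1 ∧ (3 : O) ∣ J' + 1 ∧
      ∀ ξ : L, IsPrimitiveRoot ξ p → IsCubicNorm c f J ∧ IsCubicNorm c f J' := by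
  have hcard : Fintype.card (ZMod p) = p := ZMod.card p
  obtain ⟨χ, hχ⟩ := MulChar.exists_mulChar_orderOf (ZMod p) (n := 3) (by rwa [hcard]) hη
  have hχ3 : χ ^ 3 = 1 := hχ ▸ pow_orderOf_eq_one χ
  have hinv : χ⁻¹ = χ ^ 2 := by
    rw [inv_eq_iff_mul_eq_one, ← pow_succ', hχ3]
  have hχ2 : χ ^ 2 ≠ 1 := fun h => by
    have := orderOf_dvd_of_pow_eq_one h
    rw [hχ] at this; omega
  have hχ1 : χ ≠ 1 := fun h => by rw [h, orderOf_one] at hχ; omega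
  have hcomp : χ.ringHomComp c = χ⁻¹ := by
    ext a
    rw [MulChar.ringHomComp_apply, hinv]
    obtain ⟨k, -, hk⟩ := MulChar.exists_apply_eq_pow hχ3 hη a.ne_zero
    rw [MulChar.pow_apply_coe, hk, map_pow, hc, ← pow_mul, ← pow_mul, mul_comm]
  have hcomp' : χ⁻¹.ringHomComp c = χ := by
    rw [← MulChar.ringHomComp_inv, hcomp, inv_inv]
  have hJ (φ : MulChar (ZMod p) O) (hφ : φ ^ 3 = 1) : (3 : O) ∣ jacobiSum φ φ + 1 := by
    obtain ⟨z, -, hz⟩ := exists_jacobiSum_eq_neg_one_add (n := 3) (by norm_num) hφ hφ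
      (by rwa [hcard]) hη
    have h : η ^ 2 + η + 1 = 0 := by
      have := hη.geom_sum_eq_zero (by norm_num)
      simp [Finset.sum_range_succ] at this
      linear_combination this
    refine ⟨-z * η, ?_⟩
    rw [hz]
    -- J = -1 + z(η - 1)² and (η - 1)² = -3η.
    linear_combination z * h
  have hcJ : c (jacobiSum χ χ) = jacobiSum χ⁻¹ χ⁻¹ := by
    rw [← jacobiSum_ringHomComp, hcomp]
  have hcJ' : c (jacobiSum χ⁻¹ χ⁻¹) = jacobiSum χ χ := by
    rw [← jacobiSum_ringHomComp, hcomp']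
  have hmul : jacobiSum χ χ * jacobiSum χ⁻¹ χ⁻¹ = p := by
    apply hf
    have h1 : χ.ringHomComp f ≠ 1 := (MulChar.ringHomComp_ne_one_iff hf).mpr hχ1
    have h2 : χ.ringHomComp f * χ.ringHomComp f ≠ 1 := by
      rw [← MulChar.ringHomComp_mul, ← pow_two]
      exact (MulChar.ringHomComp_ne_one_iff hf).mpr hχ2
    have := jacobiSum_mul_jacobiSum_inv (F := ZMod p) (F' := L) (by
      rw [ringChar.eq_zero, ZMod.ringChar_zmod_n]
      exact (Fact.out : p.Prime).ne_zero.symm) h1 h1 h2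
    rw [map_mul, ← jacobiSum_ringHomComp, ← jacobiSum_ringHomComp,
      ← MulChar.ringHomComp_inv, this]
    simp
  have hg (ξ : L) (hξ : IsPrimitiveRoot ξ p) (φ : MulChar (ZMod p) O) (hφ : orderOf φ = 3) :
      ∃ y : L, y ^ 3 = f (p * jacobiSum φ φ) := by
    have ho : orderOf (φ.ringHomComp f) = 3 := by
      rw [← hφ]
      refine orderOf_eq_orderOf_iff.mpr fun n => ?_
      rw [MulChar.ringHomComp_pow]
      exact MulChar.ringHomComp_eq_one_iff hf
    have := gaussSum_pow_eq_prod_jacobiSum (χ := φ.ringHomComp f) (by omega)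
      (AddChar.zmodChar_primitive_of_primitive_root p hξ)
    rw [ho] at this
    -- The sign χ(-1) is harmless: -1 is a cube.
    have hneg : (φ.ringHomComp f) (-1) = 1 ∨ (φ.ringHomComp f) (-1) = -1 := by
      rw [← sq_eq_one_iff, ← map_pow]; simp
    simp only [Nat.add_one_sub_one, show Finset.Ico 1 2 = {1} from rfl, Finset.prod_singleton,
      pow_one, jacobiSum_ringHomComp, hcard] at this
    rcases hneg with h | h <;> rw [h] at this
    · exact ⟨_, by rw [this]; simp⟩
    · exact ⟨-gaussSum (φ.ringHomComp f) _, by rw [Odd.neg_pow (by decide), this]; simp⟩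
  refine ⟨_, _, hmul, hcJ, hcJ', hJ _ hχ3, hJ _ (by rw [inv_pow, hχ3, inv_one]),
    fun ξ hξ => ⟨?_, ?_⟩⟩
  · obtain ⟨y, hy⟩ := hg ξ hξ χ hχ
    exact ⟨y, by rw [hy, hcJ, ← hmul]; congr 1; ring⟩
  · obtain ⟨y, hy⟩ := hg ξ hξ χ⁻¹ (by rw [orderOf_inv, hχ])
    exact ⟨y, by rw [hy, hcJ', ← hmul]; congr 1; ring⟩

/-- An element that is prime to 3, up to the prime `μ` above 3 and a unit, is a product of primary
elements. -/
theorem exists_eq_unit_mul_pow_mul {O L : Type*} [CommRing O] [IsDomain O]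
    [UniqueFactorizationMonoid O] [Field L] {c : O →+* O} {f : O →+* L} {μ : O}
    (hμ : ∀ q, Prime q → q ∣ 3 → Associated q μ) (x : O) (hx : x ≠ 0)
    (h : ∀ q i, Prime q → ¬ q ∣ 3 → 0 < i → q ^ i ∣ x → ¬ q ^ (i + 1) ∣ x →
      ∃ J, Associated J q ∧ (3 : O) ∣ J + 1 ∧ (¬ 3 ∣ i → IsCubicNorm c f J)) :
    ∃ (u : Oˣ) (k : ℕ) (y : O), x = u * μ ^ k * y ∧ ((3 : O) ∣ y - 1 ∨ (3 : O) ∣ y + 1) ∧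
      IsCubicNorm c f y := by
  induction x using UniqueFactorizationMonoid.induction_on_coprime with
  | h0 => exact absurd rfl hx
  | @h1 x hu => exact ⟨hu.unit, 0, 1, by simp, by simp, IsCubicNorm.one⟩
  | @hpr q i hq =>
    by_cases hq3 : q ∣ 3
    · obtain ⟨u, hu⟩ := (hμ q hq hq3).symm
      exact ⟨u ^ i, i, 1, by rw [← hu]; push_cast; ring, by simp, IsCubicNorm.one⟩
    · rcases Nat.eq_zero_or_pos i with rfl | hi
      · exact ⟨1, 0, 1, by simp, by simp, IsCubicNorm.one⟩
      obtain ⟨J, ⟨u, hu⟩, hJ, hJ'⟩ := h q i hq hq3 hi dvd_rfl (fun hd => by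
        have := (pow_dvd_pow_iff hq.ne_zero hq.not_isUnit).mp hd
        omega)
      refine ⟨u ^ i, 0, J ^ i, by rw [← hu]; push_cast; ring, ?_, ?_⟩
      · rcases Nat.even_or_odd i with he | ho
        · left
          refine hJ.trans ?_
          have := sub_dvd_pow_sub_pow J (-1) i
          rwa [he.neg_one_pow, sub_neg_eq_add] at this
        · right
          refine hJ.trans ?_
          have := sub_dvd_pow_sub_pow J (-1) i
          rwa [ho.neg_one_pow, sub_neg_eq_add, sub_neg_eq_add] at this
      -- Nothing needs to be known about J when 3 ∣ i, since J^i is then a cube; so the roots of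
      -- unity of order p are not needed for such p.
      · by_cases h3 : 3 ∣ i
        · obtain ⟨j, rfl⟩ := h3
          rw [mul_comm, pow_mul]
          exact IsCubicNorm.cube _
        · exact (hJ' h3).pow i
  | @hcp x y hxy ihx ihy =>
    -- For coprime factors the exact exponent of q in one factor is its exponent in the product, so
    -- the hypothesis on exact exponents is inherited.
    obtain ⟨u, k, z, hz, hz3, hzc⟩ := ihx (left_ne_zero_of_mul hx) fun q i hq hq3 hi h1 h2 =>
      h q i hq hq3 hi (h1.mul_right _) fun h3 => h2 (hq.pow_dvd_of_dvd_mul_right _ (fun hy =>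
        hq.not_isUnit (hxy ((dvd_pow_self q hi.ne').trans h1) hy)) h3)
    obtain ⟨v, l, w, hw, hw3, hwc⟩ := ihy (right_ne_zero_of_mul hx) fun q i hq hq3 hi h1 h2 =>
      h q i hq hq3 hi (h1.mul_left _) fun h3 => h2 (hq.pow_dvd_of_dvd_mul_left _ (fun hy =>
        hq.not_isUnit (hxy hy ((dvd_pow_self q hi.ne').trans h1))) h3)
    refine ⟨u * v, k + l, z * w, by rw [hz, hw]; push_cast; ring, ?_, hzc.mul hwc⟩
    rcases hz3 with ⟨a, ha⟩ | ⟨a, ha⟩ <;> rcases hw3 with ⟨b, hb⟩ | ⟨b, hb⟩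
    · exact .inl ⟨a * w + b, by linear_combination w * ha + hb⟩
    · exact .inr ⟨a * w + b, by linear_combination w * ha + hb⟩
    · exact .inr ⟨a * w - b, by linear_combination w * ha - hb⟩
    · exact .inl ⟨a * w - b, by linear_combination w * ha - hb⟩

/-- Modulo p, t/3 is a root of x² + x + 1, hence an element of order 3 in the group of order p - 1.
-/
theorem three_dvd_prime_sub_one {p : ℕ} (hp : p.Prime) (hp3 : p ≠ 3) {t : ℤ}
    (h : (p : ℤ) ∣ t ^ 2 + 3 * t + 9) : 3 ∣ p - 1 := by
  have := Fact.mk hp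
  have h3 : (3 : ZMod p) ≠ 0 := fun h0 => hp3 <| by
    have : ((3 : ℕ) : ZMod p) = 0 := by exact_mod_cast h0
    rw [ZMod.natCast_eq_zero_iff] at this
    exact (Nat.prime_dvd_prime_iff_eq hp Nat.prime_three).mp this
  have h0 : (t : ZMod p) ^ 2 + 3 * t + 9 = 0 := by
    have := (ZMod.intCast_zmod_eq_zero_iff_dvd _ p).mpr h
    exact_mod_cast this
  set x : ZMod p := t / 3 with hx
  have ht : (t : ZMod p) = 3 * x := by rw [hx]; field_simp
  have hx0 : x ^ 2 + x + 1 = 0 := by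
    rw [ht] at h0
    have : (9 : ZMod p) * (x ^ 2 + x + 1) = 0 := by linear_combination h0
    refine (mul_eq_zero.mp this).resolve_left ?_
    rw [show (9 : ZMod p) = 3 * 3 by norm_num]
    exact mul_ne_zero h3 h3
  have hx1 : x ≠ 1 := fun h1 => h3 (by rw [h1] at hx0; linear_combination hx0)
  have ho : orderOf x = 3 := orderOf_eq_prime (by linear_combination (x - 1) * hx0) hx1
  have hxn : x ≠ 0 := fun h1 => by rw [h1] at hx0; simp at hx0
  rw [← ho]
  exact orderOf_dvd_of_pow_eq_one (ZMod.pow_card_sub_one_eq_one hxn)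

/-! ### Eisenstein integers and the Kummer generator t - 3ω -/

section Eisenstein

/-- The ring `ℤ[ω]` of Eisenstein integers. -/
abbrev Eisenstein : Type := 𝓞 (CyclotomicField 3 ℚ)

instance isCyclotomicExtension_rat_cyclotomicField (n : ℕ) [NeZero n] :
    IsCyclotomicExtension {n} ℚ (CyclotomicField n ℚ) :=
  have : NeZero (n : ℚ) := ⟨Nat.cast_ne_zero.mpr (NeZero.ne n)⟩
  CyclotomicField.isCyclotomicExtension n ℚ

instance : IsPrincipalIdealRing Eisenstein :=
  IsCyclotomicExtension.Rat.three_pid (CyclotomicField 3 ℚ)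

/-- A primitive cube root of unity in `ℤ[ω]`. -/
noncomputable def omega : Eisenstein :=
  (IsCyclotomicExtension.zeta_spec 3 ℚ (CyclotomicField 3 ℚ)).toInteger

theorem isPrimitiveRoot_omega : IsPrimitiveRoot omega 3 :=
  (IsCyclotomicExtension.zeta_spec 3 ℚ (CyclotomicField 3 ℚ)).toInteger_isPrimitiveRoot

theorem omega_sq_add : omega ^ 2 + omega + 1 = 0 := by
  have := isPrimitiveRoot_omega.geom_sum_eq_zero (by norm_num)
  simp [Finset.sum_range_succ] at this
  linear_combination this

theorem omega_cube : omega ^ 3 = 1 := isPrimitiveRoot_omega.pow_eq_one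

theorem prime_omega_sub_one : Prime (omega - 1) :=
  (IsCyclotomicExtension.zeta_spec 3 ℚ (CyclotomicField 3 ℚ)).zeta_sub_one_prime'

theorem associated_omega_sub_one {q : Eisenstein} (hq : Prime q) (h : q ∣ 3) :
    Associated q (omega - 1) := by
  have h3 : (3 : Eisenstein) = (omega - 1) ^ 2 * (-omega ^ 2) := by
    linear_combination (omega ^ 2 - 3 * omega + 3) * omega_sq_add
  rw [h3] at h
  have hu : IsUnit (-omega ^ 2) := ((isPrimitiveRoot_omega.isUnit (by norm_num)).pow 2).neg
  have : q ∣ omega - 1 := hq.dvd_of_dvd_pow (hu.dvd_mul_right.mp h)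
  exact (Prime.dvd_prime_iff_associated hq prime_omega_sub_one).mp this

/-- Kummer's lemma for the exponent 3; the modulus 3 is (ω - 1)² up to a unit. -/
theorem eisenstein_unit_eq (u : Eisensteinˣ) (h : ∃ n : ℤ, (3 : Eisenstein) ∣ u - n) :
    u = 1 ∨ u = -1 := by
  refine IsCyclotomicExtension.Rat.Three.eq_one_or_neg_one_of_unit_of_congruent
    (IsCyclotomicExtension.zeta_spec 3 ℚ (CyclotomicField 3 ℚ)) u ?_
  obtain ⟨n, hn⟩ := h
  refine ⟨n, dvd_trans ⟨-omega ^ 2, ?_⟩ hn⟩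
  change (3 : Eisenstein) = (omega - 1) ^ 2 * (-omega ^ 2)
  linear_combination (omega ^ 2 - 3 * omega + 3) * omega_sq_add

theorem eisenstein_unit_mem (u : Eisensteinˣ) :
    ∃ k : ℕ, (u : Eisenstein) = omega ^ k ∨ (u : Eisenstein) = -omega ^ k := by
  have := IsCyclotomicExtension.Rat.Three.Units.mem
    (IsCyclotomicExtension.zeta_spec 3 ℚ (CyclotomicField 3 ℚ)) u
  simp only [List.mem_cons, List.not_mem_nil, or_false] at this
  rcases this with h | h | h | h | h | h <;> rw [h]
  · exact ⟨0, .inl (by simp)⟩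
  · exact ⟨0, .inr (by simp)⟩
  · exact ⟨1, .inl (by simp; rfl)⟩
  · exact ⟨1, .inr (by simp; rfl)⟩
  · exact ⟨2, .inl (by simp; rfl)⟩
  · exact ⟨2, .inr (by simp; rfl)⟩

theorem exists_conj : ∃ c : Eisenstein →+* Eisenstein, c omega = omega ^ 2 := by
  have hζ := IsCyclotomicExtension.zeta_spec 3 ℚ (CyclotomicField 3 ℚ)
  have h : Irreducible (Polynomial.cyclotomic 3 ℚ) :=
    Polynomial.cyclotomic.irreducible_rat (by norm_num)
  have h2 := hζ.pow_of_coprime 2 (by norm_num)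
  refine ⟨NumberField.RingOfIntegers.mapRingHom
    (IsCyclotomicExtension.fromZetaAut h2 h : _ →+* CyclotomicField 3 ℚ), ?_⟩
  ext
  exact IsCyclotomicExtension.fromZetaAut_spec h2 h

/-- The conjugation of `ℤ[ω]`. -/
noncomputable def eisensteinConj : Eisenstein →+* Eisenstein := exists_conj.choose

theorem eisensteinConj_omega : eisensteinConj omega = omega ^ 2 := exists_conj.choose_spec

/-- The Kummer generator `t - 3ω` of `K_t(ω)`. -/
noncomputable def kummerElt (t : ℤ) : Eisenstein := t - 3 * omega

theorem conj_kummerElt (t : ℤ) : eisensteinConj (kummerElt t) = t - 3 * omega ^ 2 := by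
  rw [kummerElt, map_sub, map_mul, map_intCast, map_ofNat, eisensteinConj_omega]

theorem kummerElt_mul_conj (t : ℤ) :
    kummerElt t * eisensteinConj (kummerElt t) = (shanksDelta t : Eisenstein) := by
  rw [conj_kummerElt, kummerElt, shanksDelta]
  push_cast
  linear_combination -3 * (t : Eisenstein) * omega_sq_add + 9 * omega_cube

theorem shanksDelta_pos (t : ℤ) : 0 < shanksDelta t := by
  unfold shanksDelta; nlinarith [sq_nonneg (2 * t + 3)]

/-- The difference of the two conjugates is 3ω(ω - 1), which has only the prime above 3. -/
theorem dvd_three_of_dvd_kummerElt {q : Eisenstein} (hq : Prime q) {t : ℤ}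
    (h : q ∣ kummerElt t) (h' : q ∣ eisensteinConj (kummerElt t)) : q ∣ 3 := by
  have h1 : q ∣ 3 * omega * (omega - 1) := by
    convert dvd_sub h h' using 1
    rw [conj_kummerElt, kummerElt]; ring
  rcases hq.dvd_or_dvd h1 with h2 | h2
  · exact ((isPrimitiveRoot_omega.isUnit (by norm_num)).dvd_mul_right.mp h2)
  · refine (dvd_pow h2 two_ne_zero).trans ⟨-omega ^ 2, ?_⟩
    linear_combination (omega ^ 2 - 3 * omega + 3) * omega_sq_add

theorem exists_nat_prime_dvd {q : Eisenstein} (hq : Prime q) {n : ℤ} (hn : n ≠ 0)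
    (h : q ∣ (n : Eisenstein)) : ∃ p : ℕ, p.Prime ∧ (p : ℤ) ∣ n ∧ q ∣ (p : Eisenstein) := by
  have h1 : q ∣ ((n.natAbs : ℕ) : Eisenstein) := by
    rcases Int.natAbs_eq n with h2 | h2 <;> rw [h2] at h
    · simpa using h
    · simpa using h
  rw [← Nat.prod_primeFactorsList (Int.natAbs_ne_zero.mpr hn), Nat.cast_list_prod,
    hq.dvd_prod_iff] at h1
  obtain ⟨a, ha, hqa⟩ := h1
  obtain ⟨p, hp, rfl⟩ := List.mem_map.mp ha
  exact ⟨p, Nat.prime_of_mem_primeFactorsList hp,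
    Int.natCast_dvd.mpr (Nat.dvd_of_mem_primeFactorsList hp), hqa⟩

/-- The norms of J and J' multiply to p². Conjugation exchanges J and J', so neither is a unit, and
J has norm p. -/
theorem prime_of_mul_eq_prime {p : ℕ} (hp : p.Prime) {J J' : Eisenstein} (h : J * J' = p)
    (hJ : eisensteinConj J = J') (hJ' : eisensteinConj J' = J) : Prime J := by
  have hN : Ideal.absNorm (Ideal.span {J}) * Ideal.absNorm (Ideal.span {J'}) = p ^ 2 := by
    rw [← map_mul, Ideal.span_singleton_mul_span_singleton, h, Ideal.absNorm_span_singleton]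
    have : ((p : ℕ) : Eisenstein) = algebraMap ℤ Eisenstein p := by simp
    rw [this, Algebra.norm_algebraMap, NumberField.RingOfIntegers.rank,
      IsCyclotomicExtension.finrank (n := 3) (CyclotomicField 3 ℚ)
        (Polynomial.cyclotomic.irreducible_rat (by norm_num)), Int.natAbs_pow]
    rfl
  have hpn : ¬ IsUnit (p : Eisenstein) := fun hu => by
    have := Ideal.absNorm_span_singleton ((p : ℕ) : Eisenstein)
    rw [Ideal.span_singleton_eq_top.mpr hu, ← h, ← Ideal.absNorm_span_singleton,
      ← Ideal.span_singleton_mul_span_singleton, map_mul, hN, Ideal.absNorm_top] at this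
    have := hp.one_lt
    nlinarith
  have hu : ¬ IsUnit J := fun hu => hpn (h ▸ hu.mul (hJ ▸ hu.map eisensteinConj))
  have hu' : ¬ IsUnit J' := fun hu => hpn (h ▸ IsUnit.mul (hJ' ▸ hu.map eisensteinConj) hu)
  have h1 : Ideal.absNorm (Ideal.span {J}) = p := by
    refine ((hp.mul_eq_prime_sq_iff ?_ ?_).mp hN).1
    · rwa [Ne, Ideal.absNorm_eq_one_iff, Ideal.span_singleton_eq_top]
    · rwa [Ne, Ideal.absNorm_eq_one_iff, Ideal.span_singleton_eq_top]
  have hJ0 : J ≠ 0 := fun h0 => by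
    rw [h0, zero_mul] at h
    exact hp.ne_zero (by exact_mod_cast h.symm)
  rw [← Ideal.span_singleton_prime hJ0]
  exact Ideal.isPrime_of_irreducible_absNorm (by rw [h1]; exact hp)

/-- This supplies the local input of `exists_eq_unit_mul_pow_mul` for t - 3ω. A prime q ∤ 3 dividing
π does not divide π̄, so its exponent i in π is the exponent of p in `Δ_t`; the roots of unity of
order p are thus at hand when 3 ∤ i. -/
theorem exists_associated_isCubicNorm {L : Type*} [Field L] [CharZero L] {f : Eisenstein →+* L}
    {t : ℤ} (hL : ∀ (p a : ℕ) (b : ℤ), p.Prime → p ≠ 3 → shanksDelta t = p ^ a * b →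
      ¬ (p : ℤ) ∣ b → ¬ 3 ∣ a → ∃ ξ : L, IsPrimitiveRoot ξ p)
    {q : Eisenstein} {i : ℕ} (hq : Prime q) (hq3 : ¬ q ∣ 3) (hi : 0 < i)
    (h1 : q ^ i ∣ kummerElt t) (h2 : ¬ q ^ (i + 1) ∣ kummerElt t) :
    ∃ J, Associated J q ∧ (3 : Eisenstein) ∣ J + 1 ∧
      (¬ 3 ∣ i → IsCubicNorm eisensteinConj f J) := by
  have hqπ : q ∣ kummerElt t := (dvd_pow_self q hi.ne').trans h1
  -- A nonzero x divides the norm of (x), a nonzero integer, which survives in characteristic zero.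
  have hf : Function.Injective f := by
    rw [injective_iff_map_eq_zero]
    intro x hx
    by_contra hx0
    have := Ideal.absNorm_mem (Ideal.span {x})
    rw [Ideal.mem_span_singleton] at this
    obtain ⟨y, hy⟩ := this
    have h3 := congrArg f hy
    rw [map_mul, hx, zero_mul, map_natCast, Nat.cast_eq_zero, Ideal.absNorm_eq_zero_iff,
      Ideal.span_singleton_eq_bot] at h3
    exact hx0 h3
  obtain ⟨p, hp, hpΔ, hqp⟩ := exists_nat_prime_dvd hq (shanksDelta_pos t).ne'
    (by rw [← kummerElt_mul_conj]; exact hqπ.mul_right _)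
  have hp3 : p ≠ 3 := fun h => hq3 (by simpa [h] using hqp)
  have := Fact.mk hp
  obtain ⟨J₁, J₂, hJ12, hJ1, hJ2, h31, h32, hN⟩ := MulChar.exists_cubic_jacobiSum hf
    isPrimitiveRoot_omega eisensteinConj_omega (three_dvd_prime_sub_one hp hp3 hpΔ)
  obtain ⟨J, J', hJJ, hJ, hJ', h3, hN, hqJ⟩ : ∃ J J' : Eisenstein, J * J' = p ∧
      eisensteinConj J = J' ∧ eisensteinConj J' = J ∧ 3 ∣ J + 1 ∧
      (∀ ξ : L, IsPrimitiveRoot ξ p → IsCubicNorm eisensteinConj f J) ∧ q ∣ J := by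
    rcases hq.dvd_or_dvd (hJ12 ▸ hqp) with h | h
    · exact ⟨J₁, J₂, hJ12, hJ1, hJ2, h31, fun ξ hξ => (hN ξ hξ).1, h⟩
    · exact ⟨J₂, J₁, by rw [mul_comm, hJ12], hJ2, hJ1, h32, fun ξ hξ => (hN ξ hξ).2, h⟩
  have hJp := prime_of_mul_eq_prime hp hJJ hJ hJ'
  have has : Associated q J := (Prime.dvd_prime_iff_associated hq hJp).mp hqJ
  refine ⟨J, has.symm, h3, fun hi3 => ?_⟩
  have hqc : ¬ q ∣ eisensteinConj (kummerElt t) := fun h =>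
    hq3 (dvd_three_of_dvd_kummerElt hq hqπ h)
  have hqJ' : ¬ q ∣ J' := fun h => hqc (by
    refine h.trans ?_
    rw [← hJ]
    exact map_dvd eisensteinConj (has.dvd'.trans hqπ))
  have hfin : FiniteMultiplicity (p : ℤ) (shanksDelta t) :=
    Int.finiteMultiplicity_iff.mpr ⟨by simpa using hp.one_lt.ne', (shanksDelta_pos t).ne'⟩
  obtain ⟨b, hb, hpb⟩ := hfin.exists_eq_pow_mul_and_not_dvd
  set a := multiplicity (p : ℤ) (shanksDelta t)
  have hqb : ¬ q ∣ (b : Eisenstein) := fun h => by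
    have hcop : IsCoprime (p : ℤ) b :=
      (Prime.coprime_iff_not_dvd (Nat.prime_iff_prime_int.mp hp)).mpr hpb
    obtain ⟨u, v, huv⟩ := hcop
    have : q ∣ ((u * p + v * b : ℤ) : Eisenstein) := by
      push_cast
      exact dvd_add (hqp.mul_left _) (h.mul_left _)
    rw [huv, Int.cast_one] at this
    exact hq.not_isUnit (isUnit_of_dvd_one this)
  -- The exponent of q in `Δ_t` is counted twice: from ππ̄ it is i, from p^a b with p = JJ' it is a.
  have e1 : emultiplicity q (shanksDelta t : Eisenstein) = i := by
    rw [← kummerElt_mul_conj, emultiplicity_mul hq, emultiplicity_eq_zero.mpr hqc, add_zero]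
    exact emultiplicity_eq_coe.mpr ⟨h1, h2⟩
  have e2 : emultiplicity q (shanksDelta t : Eisenstein) = a := by
    rw [hb]
    push_cast
    rw [← hJJ, mul_pow, emultiplicity_mul hq, emultiplicity_mul hq,
      emultiplicity_eq_zero.mpr hqb, emultiplicity_pow hq, emultiplicity_pow hq,
      emultiplicity_eq_zero.mpr hqJ', emultiplicity_eq_of_associated_right has.symm]
    have : emultiplicity q q = 1 := by
      simpa using (FiniteMultiplicity.of_prime_left hq hq.ne_zero).emultiplicity_self
    simp [this]
  have hia : i = a := by exact_mod_cast e1.symm.trans e2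
  obtain ⟨ξ, hξ⟩ := hL p a b hp hp3 hb hpb (hia ▸ hi3)
  exact hN ξ hξ

theorem kummerElt_ne_zero (t : ℤ) : kummerElt t ≠ 0 := fun h => by
  have := kummerElt_mul_conj t
  rw [h, zero_mul] at this
  exact (shanksDelta_pos t).ne' (by exact_mod_cast this.symm)

theorem not_omega_sub_one_dvd {n : ℤ} (hn : ¬ 3 ∣ n) {z : Eisenstein} (hz : (3 : Eisenstein) ∣ z - n) :
    ¬ omega - 1 ∣ z := fun h => by
  have h3 : omega - 1 ∣ (3 : Eisenstein) := ⟨(omega - 1) * (-omega ^ 2), by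
    linear_combination (omega ^ 2 - 3 * omega + 3) * omega_sq_add⟩
  have hn' : omega - 1 ∣ (n : Eisenstein) := by
    have := dvd_sub h (h3.trans hz)
    rwa [sub_sub_cancel] at this
  obtain ⟨a, b, hab⟩ := (Prime.coprime_iff_not_dvd Int.prime_three).mpr hn
  have : omega - 1 ∣ ((a * 3 + b * n : ℤ) : Eisenstein) := by
    push_cast
    exact dvd_add (h3.mul_left _) (hn'.mul_left _)
  rw [hab, Int.cast_one] at this
  exact prime_omega_sub_one.not_isUnit (isUnit_of_dvd_one this)

/-- Both y and z are prime to ω - 1, so the powers agree; then u is congruent to a rational integer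
mod 3 and `eisenstein_unit_eq` applies. -/
theorem unit_eq_of_pow_mul_eq {u : Eisensteinˣ} {k j : ℕ} {y z : Eisenstein} {n : ℤ}
    (hn : ¬ 3 ∣ n) (hz : (3 : Eisenstein) ∣ z - n)
    (hy : (3 : Eisenstein) ∣ y - 1 ∨ (3 : Eisenstein) ∣ y + 1)
    (h : (omega - 1) ^ j * z = u * (omega - 1) ^ k * y) : k = j ∧ (u = 1 ∨ u = -1) := by
  have hμ := prime_omega_sub_one.ne_zero
  have hzn := not_omega_sub_one_dvd hn hz
  have hyn : ¬ omega - 1 ∣ y := by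
    rcases hy with hy | hy
    · exact not_omega_sub_one_dvd (n := 1) (by norm_num) (by simpa using hy)
    · exact not_omega_sub_one_dvd (n := -1) (by norm_num) (by simpa using hy)
  have hkj : k = j := by
    rcases lt_trichotomy k j with hlt | he | hlt
    · obtain ⟨d, rfl⟩ := Nat.exists_eq_add_of_lt hlt
      have : (omega - 1) ^ (d + 1) * z = u * y := by
        apply mul_left_cancel₀ (pow_ne_zero k hμ)
        linear_combination h
      exact absurd ((u.isUnit.dvd_mul_left).mp
        (this ▸ (dvd_pow_self (omega - 1) (Nat.succ_ne_zero d)).mul_right z)) hyn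
    · exact he
    · obtain ⟨d, rfl⟩ := Nat.exists_eq_add_of_lt hlt
      have : z = u * (omega - 1) ^ (d + 1) * y := by
        apply mul_left_cancel₀ (pow_ne_zero j hμ)
        linear_combination h
      exact absurd (this ▸ (((dvd_pow_self (omega - 1) (Nat.succ_ne_zero d)).mul_left _).mul_right y))
        hzn
  subst hkj
  have hzy : z = u * y := by
    apply mul_left_cancel₀ (pow_ne_zero k hμ)
    linear_combination h
  refine ⟨rfl, eisenstein_unit_eq u ?_⟩
  obtain ⟨a, ha⟩ := hz
  rcases hy with ⟨b, hb⟩ | ⟨b, hb⟩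
  · exact ⟨n, a - u * b, by linear_combination ha - hzy - u * hb⟩
  · exact ⟨-n, -a + u * b, by push_cast; linear_combination -ha + hzy + u * hb⟩

theorem isCubicNorm_of_pow_mul_eq {L : Type*} [Field L] {f : Eisenstein →+* L} {u : Eisensteinˣ}
    {k j : ℕ} {y z : Eisenstein} {n : ℤ} (hn : ¬ 3 ∣ n) (hz : (3 : Eisenstein) ∣ z - n)
    (hy : (3 : Eisenstein) ∣ y - 1 ∨ (3 : Eisenstein) ∣ y + 1)
    (hyc : IsCubicNorm eisensteinConj f y)
    (h : (omega - 1) ^ j * z = u * (omega - 1) ^ k * y) (hj : 3 ∣ j) :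
    IsCubicNorm eisensteinConj f (u * (omega - 1) ^ k * y) := by
  obtain ⟨rfl, hu⟩ := unit_eq_of_pow_mul_eq hn hz hy h
  obtain ⟨i, rfl⟩ := hj
  have : IsCubicNorm eisensteinConj f ((omega - 1) ^ (3 * i) * y) := by
    rw [mul_comm 3, pow_mul]
    exact (IsCubicNorm.cube _).mul hyc
  rcases hu with rfl | rfl
  · simpa using this
  · simpa using this.neg

theorem isCubicNorm_omega {L : Type*} [Field L] {f : Eisenstein →+* L} {ξ : L}
    (hξ : ξ ^ 3 = f omega) : IsCubicNorm eisensteinConj f omega :=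
  ⟨ξ, by rw [hξ, eisensteinConj_omega]; congr 1; linear_combination -omega * omega_cube⟩

/-- With λ = ω - 1 one has λ̄ = -ω²λ, so λ²λ̄ = -λ³ω² is a cube once ω is. -/
theorem isCubicNorm_omega_sub_one {L : Type*} [Field L] {f : Eisenstein →+* L} {ξ : L}
    (hξ : ξ ^ 3 = f omega) : IsCubicNorm eisensteinConj f (omega - 1) := by
  refine ⟨-f (omega - 1) * ξ ^ 2, ?_⟩
  have : (-f (omega - 1) * ξ ^ 2) ^ 3 = f (-(omega - 1) ^ 3 * omega ^ 2) := by
    simp only [map_mul, map_neg, map_pow, ← hξ]; ring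
  rw [this]
  congr 1
  rw [map_sub, map_one, eisensteinConj_omega]
  linear_combination -(omega - 1) ^ 3 * omega_sq_add

theorem exists_cube_eq_omega {L : Type*} [Field L] {f : Eisenstein →+* L} {ξ : L}
    (hξ : IsPrimitiveRoot ξ 9) : ∃ x : L, x ^ 3 = f omega := by
  have h3 : IsPrimitiveRoot (ξ ^ 3) 3 := hξ.pow (by norm_num) (by norm_num)
  obtain ⟨i, -, hi⟩ := h3.eq_pow_of_pow_eq_one (ξ := f omega)
    (by rw [← map_pow, omega_cube, map_one])
  exact ⟨ξ ^ i, by rw [← hi, ← pow_mul, ← pow_mul, mul_comm]⟩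

/-- The primary part of π is handled by Jacobi sums; the unit and the power of ω - 1 remain. If 3 ∤
t, or if t ≡ 12 mod 27, congruences mod 3 make the unit ±1 and the power of ω - 1 a cube. Otherwise
a ninth root of unity, a cube root of ω, takes care of both. -/
theorem isCubicNorm_kummerElt {L : Type*} [Field L] [CharZero L] (f : Eisenstein →+* L)
    {t : ℤ} (hL : ∀ (p a : ℕ) (b : ℤ), p.Prime → p ≠ 3 → shanksDelta t = p ^ a * b →
      ¬ (p : ℤ) ∣ b → ¬ 3 ∣ a → ∃ ξ : L, IsPrimitiveRoot ξ p)
    (hL3 : 3 ∣ t → ¬ 27 ∣ t - 12 → ∃ ξ : L, IsPrimitiveRoot ξ 9) :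
    IsCubicNorm eisensteinConj f (kummerElt t) := by
  obtain ⟨u, k, y, hy, hy3, hyc⟩ := exists_eq_unit_mul_pow_mul (c := eisensteinConj) (f := f)
    (fun _ => associated_omega_sub_one) (kummerElt t) (kummerElt_ne_zero t)
    (fun q i hq hq3 hi h1 h2 => exists_associated_isCubicNorm hL hq hq3 hi h1 h2)
  by_cases h3 : 3 ∣ t
  · by_cases h27 : 27 ∣ t - 12
    · obtain ⟨s, hs⟩ := h27
      obtain rfl : t = 12 + 27 * s := by omega
      rw [hy]
      -- Here z is the quotient of 12 + 27s - 3ω by (ω - 1)³ = 3 + 6ω.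
      refine isCubicNorm_of_pow_mul_eq (n := 1) (z := 1 + 3 * (-1 - omega + s * (omega ^ 2 - omega)))
        (j := 3) (by norm_num) ⟨-1 - omega + s * (omega ^ 2 - omega), by push_cast; ring⟩
        hy3 hyc ?_ (by norm_num)
      rw [← hy, kummerElt]
      push_cast
      linear_combination (-10 - 27 * s + (10 + 30 * (s : Eisenstein)) * omega +
        (-3 - 15 * s) * omega ^ 2 + 3 * s * omega ^ 3) * omega_sq_add
    · obtain ⟨ξ, hξ⟩ := hL3 h3 h27
      obtain ⟨x, hx⟩ := exists_cube_eq_omega (f := f) hξ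
      rw [hy]
      refine ((?_ : IsCubicNorm _ _ _).mul ((isCubicNorm_omega_sub_one hx).pow k)).mul hyc
      obtain ⟨i, hi | hi⟩ := eisenstein_unit_mem u
      · rw [hi]; exact (isCubicNorm_omega hx).pow i
      · rw [hi]; exact ((isCubicNorm_omega hx).pow i).neg
  · rw [hy]
    refine isCubicNorm_of_pow_mul_eq (n := t) (z := kummerElt t) (j := 0) h3
      ⟨-omega, by rw [kummerElt]; ring⟩ hy3 hyc ?_ (by norm_num)
    rw [← hy, pow_zero, one_mul]

theorem aeval_shanksPoly {R : Type*} [CommRing R] (t : ℤ) (x : R) :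
    Polynomial.aeval x (shanksPoly t) = x ^ 3 - t * x ^ 2 - (t + 3) * x - 1 := by
  simp only [shanksPoly, map_sub, map_mul, map_pow, Polynomial.aeval_X, Polynomial.aeval_C, map_one,
    algebraMap_int_eq, eq_intCast (Int.castRingHom R), Int.cast_add, Int.cast_ofNat]

/-- Cardano's formula for the Shanks cubic. -/
theorem exists_root_of_primitiveRoots {L : Type*} [Field L] [CharZero L] {t : ℤ} {ω : L}
    (hω : IsPrimitiveRoot ω 3)
    (hL : ∀ (p a : ℕ) (b : ℤ), p.Prime → p ≠ 3 → shanksDelta t = p ^ a * b →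
      ¬ (p : ℤ) ∣ b → ¬ 3 ∣ a → ∃ ξ : L, IsPrimitiveRoot ξ p)
    (hL3 : 3 ∣ t → ¬ 27 ∣ t - 12 → ∃ ξ : L, IsPrimitiveRoot ξ 9) :
    ∃ x : L, Polynomial.aeval x (shanksPoly t) = 0 := by
  have hζ := IsCyclotomicExtension.zeta_spec 3 ℚ (CyclotomicField 3 ℚ)
  let g : CyclotomicField 3 ℚ →ₐ[ℚ] L := (hζ.powerBasis ℚ).lift ω (by
    rw [IsPrimitiveRoot.powerBasis_gen ℚ hζ,
      ← Polynomial.cyclotomic_eq_minpoly_rat hζ (by norm_num)]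
    have := hω.isRoot_cyclotomic (by norm_num)
    rwa [Polynomial.aeval_def, Polynomial.eval₂_eq_eval_map, Polynomial.map_cyclotomic])
  let f : Eisenstein →+* L := g.toRingHom.comp (algebraMap Eisenstein (CyclotomicField 3 ℚ))
  obtain ⟨ρ, hρ⟩ := isCubicNorm_kummerElt f hL hL3
  set P := f (kummerElt t)
  set Q := f (eisensteinConj (kummerElt t))
  have hPQ : P * Q = t ^ 2 + 3 * t + 9 := by
    rw [← map_mul, kummerElt_mul_conj, map_intCast, shanksDelta]; push_cast; ring
  have hPQ' : P + Q = 2 * t + 3 := by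
    rw [← map_add, conj_kummerElt, kummerElt,
      show (t : Eisenstein) - 3 * omega + (t - 3 * omega ^ 2) = ((2 * t + 3 : ℤ) : Eisenstein) by
        push_cast; linear_combination -3 * omega_sq_add, map_intCast]
    push_cast; ring
  have hρ3 : ρ ^ 3 = P ^ 2 * Q := by rw [hρ, map_mul, map_pow]
  have hΔ : P * Q ≠ 0 := by
    rw [hPQ]
    exact_mod_cast (shanksDelta_pos t).ne'
  have hP : P ≠ 0 := left_ne_zero_of_mul hΔ
  have hQ : Q ≠ 0 := right_ne_zero_of_mul hΔ
  have hρ0 : ρ ≠ 0 := fun h => by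
    rw [h] at hρ3
    exact (mul_ne_zero (pow_ne_zero 2 hP) hQ) (by rw [← hρ3]; norm_num)
  -- The second cube root is fixed by ρτ = Δ. With y = 3x - t the cubic reads y³ - 3Δy - (2t + 3)Δ =
  -- 0, and ρ³ + τ³ = PQ(P + Q) = (2t + 3)Δ, so y = ρ + τ is a root.
  obtain ⟨τ, hτ⟩ : ∃ τ : L, ρ * τ = P * Q := ⟨P * Q / ρ, by field_simp⟩
  have hτ3 : τ ^ 3 = P * Q ^ 2 := by
    apply mul_left_cancel₀ (pow_ne_zero 3 hρ0)
    rw [← mul_pow, hτ, hρ3]; ring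
  refine ⟨(t + ρ + τ) / 3, ?_⟩
  rw [aeval_shanksPoly]
  have h27 : (27 : L) ≠ 0 := by norm_num
  apply mul_left_cancel₀ h27
  have h3 : (3 : L) ≠ 0 := by norm_num
  field_simp
  linear_combination hρ3 + hτ3 + 3 * (ρ + τ) * (hτ + hPQ) + P * Q * hPQ' + (2 * t + 3) * hPQ

end Eisenstein

/-! ### Irreducibility of the Shanks cubic -/

section Polynomial

open Polynomial

theorem shanksPoly_eq (t : ℤ) : shanksPoly t = X ^ 3 + C (-t) * X ^ 2 + C (-(t + 3)) * X + C (-1) := by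
  simp only [shanksPoly, map_neg, map_one]; ring

theorem shanksPoly_natDegree (t : ℤ) : (shanksPoly t).natDegree = 3 := by
  rw [shanksPoly_eq]; compute_degree!

theorem shanksPoly_monic (t : ℤ) : (shanksPoly t).Monic := by
  rw [shanksPoly_eq]; monicity!

theorem isRoot_map_shanksPoly {F : Type*} [Field F] {t : ℤ} {x : F} :
    ((shanksPoly t).map (algebraMap ℤ F)).IsRoot x ↔ aeval x (shanksPoly t) = 0 := by
  rw [IsRoot, eval_map_algebraMap]

theorem irreducible_map_shanksPoly_of_forall {F : Type*} [Field F] {t : ℤ}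
    (h : ∀ x : F, aeval x (shanksPoly t) ≠ 0) :
    Irreducible ((shanksPoly t).map (algebraMap ℤ F)) := by
  have hm := (shanksPoly_monic t).map (algebraMap ℤ F)
  have hd : ((shanksPoly t).map (algebraMap ℤ F)).natDegree = 3 := by
    rw [(shanksPoly_monic t).natDegree_map, shanksPoly_natDegree]
  rw [hm.irreducible_iff_roots_eq_zero_of_degree_le_three (by omega) (by omega)]
  refine Multiset.eq_zero_of_forall_notMem fun x hx => h x ?_
  exact isRoot_map_shanksPoly.mp (isRoot_of_mem_roots hx)

theorem aeval_shanksPoly_rat_ne_zero (t : ℤ) (x : ℚ) : aeval x (shanksPoly t) ≠ 0 := fun h => by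
  have hx : IsIntegral ℤ x := ⟨shanksPoly t, shanksPoly_monic t, by rwa [← aeval_def]⟩
  obtain ⟨n, rfl⟩ := IsIntegrallyClosed.isIntegral_iff.mp hx
  rw [aeval_shanksPoly] at h
  have h' : n * (n ^ 2 - t * n - (t + 3)) = 1 := by
    have : ((n * (n ^ 2 - t * n - (t + 3)) : ℤ) : ℚ) = 1 := by
      push_cast
      simp only [algebraMap_int_eq, eq_intCast] at h
      linear_combination h
    exact_mod_cast this
  -- The only candidates are ±1, but f(1) = -2t - 3 is odd and f(-1) = 1.
  rcases Int.eq_one_or_neg_one_of_mul_eq_one h' with rfl | rfl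
  · omega
  · omega

theorem irreducible_map_shanksPoly (t : ℤ) :
    Irreducible ((shanksPoly t).map (algebraMap ℤ ℚ)) :=
  irreducible_map_shanksPoly_of_forall (aeval_shanksPoly_rat_ne_zero t)

theorem minpoly_eq_map_shanksPoly {F L : Type*} [Field F] [Field L] [Algebra F L] {t : ℤ} {x : L}
    (h : Irreducible ((shanksPoly t).map (algebraMap ℤ F))) (hx : aeval x (shanksPoly t) = 0) :
    minpoly F x = (shanksPoly t).map (algebraMap ℤ F) := by
  refine (minpoly.eq_of_irreducible_of_monic h ?_ ((shanksPoly_monic t).map _)).symm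
  rwa [aeval_map_algebraMap]

/-- A Shanks cubic with a root in a finite extension of degree prime to 3 has a root in the base. -/
theorem exists_root_of_not_three_dvd_finrank {F L : Type*} [Field F] [Field L] [Algebra F L]
    [FiniteDimensional F L] (h3 : ¬ 3 ∣ Module.finrank F L) {t : ℤ}
    (h : ∃ x : L, aeval x (shanksPoly t) = 0) : ∃ x : F, aeval x (shanksPoly t) = 0 := by
  by_contra! hF
  obtain ⟨x, hx⟩ := h
  have hirr := irreducible_map_shanksPoly_of_forall hF
  have := minpoly.degree_dvd (IsIntegral.of_finite F x)
  rw [minpoly_eq_map_shanksPoly hirr hx, (shanksPoly_monic t).natDegree_map,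
    shanksPoly_natDegree] at this
  exact h3 this

end Polynomial

/-! ### Roots of the cubic in cyclotomic fields -/

section Cyclotomic

theorem nonempty_cyclotomicField_algHom {L : Type*} [Field L] [CharZero L] {n : ℕ} [NeZero n] {ζ : L}
    (hζ : IsPrimitiveRoot ζ n) : Nonempty (CyclotomicField n ℚ →ₐ[ℚ] L) := by
  have h := IsCyclotomicExtension.zeta_spec n ℚ (CyclotomicField n ℚ)
  refine ⟨(h.powerBasis ℚ).lift ζ ?_⟩
  rw [IsPrimitiveRoot.powerBasis_gen ℚ h,
    ← Polynomial.cyclotomic_eq_minpoly_rat h (Nat.pos_of_neZero n)]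
  have := hζ.isRoot_cyclotomic (Nat.pos_of_neZero n)
  rwa [Polynomial.aeval_def, Polynomial.eval₂_eq_eval_map, Polynomial.map_cyclotomic]

theorem exists_isPrimitiveRoot_of_dvd {L : Type*} [Field L] {n d : ℕ} (hn : 0 < n) {ζ : L}
    (hζ : IsPrimitiveRoot ζ n) (h : d ∣ n) : ∃ ξ : L, IsPrimitiveRoot ξ d := by
  obtain ⟨e, rfl⟩ := h
  exact ⟨ζ ^ e, hζ.pow hn (mul_comm _ _)⟩

section

variable (F : Type*) [Field F] [CharZero F]

theorem not_three_dvd_finrank_cyclotomicField_three :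
    ¬ 3 ∣ Module.finrank F (CyclotomicField 3 F) := by
  have h := IsCyclotomicExtension.zeta_spec 3 F (CyclotomicField 3 F)
  have : NeZero ((3 : ℕ) : F) := ⟨by norm_num⟩
  have hfin : FiniteDimensional F (CyclotomicField 3 F) :=
    IsCyclotomicExtension.finite_of_singleton 3 F _
  rw [(h.powerBasis F).finrank, ← PowerBasis.natDegree_minpoly, IsPrimitiveRoot.powerBasis_gen F h]
  have hdvd : minpoly F (IsCyclotomicExtension.zeta 3 F (CyclotomicField 3 F)) ∣
      Polynomial.cyclotomic 3 F := by
    apply minpoly.dvd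
    have := h.isRoot_cyclotomic (by norm_num)
    rwa [Polynomial.aeval_def, Polynomial.eval₂_eq_eval_map, Polynomial.map_cyclotomic]
  have h1 := Polynomial.natDegree_le_of_dvd hdvd (Polynomial.cyclotomic_ne_zero 3 F)
  rw [Polynomial.natDegree_cyclotomic, show Nat.totient 3 = 2 by decide] at h1
  have h2 := minpoly.natDegree_pos
    (IsIntegral.of_finite F (IsCyclotomicExtension.zeta 3 F (CyclotomicField 3 F)))
  intro h3
  have := Nat.le_of_dvd h2 h3
  omega

end

theorem exists_root_of_root_cyclotomicField_three {F : Type*} [Field F] [CharZero F] {t : ℤ}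
    (h : ∃ x : CyclotomicField 3 F, Polynomial.aeval x (shanksPoly t) = 0) :
    ∃ x : F, Polynomial.aeval x (shanksPoly t) = 0 :=
  have : FiniteDimensional F (CyclotomicField 3 F) := IsCyclotomicExtension.finite_of_singleton 3 F _
  exists_root_of_not_three_dvd_finrank (not_three_dvd_finrank_cyclotomicField_three F) h

theorem map_root {A B : Type*} [CommRing A] [CommRing B] (f : A →+* B) {t : ℤ} {x : A}
    (h : Polynomial.aeval x (shanksPoly t) = 0) : Polynomial.aeval (f x) (shanksPoly t) = 0 := by
  rw [aeval_shanksPoly] at h ⊢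
  rw [← map_zero f, ← h]
  simp [map_ofNat f 3]

/-- ℚ(ζ_{3m}) embeds in ℚ(ζ_m)(ζ₃), of degree at most 2 over ℚ(ζ_m), and a cubic acquires no first
root in such an extension. -/
theorem exists_root_cyclotomicField_of_three_mul {m : ℕ} (hm : ¬ 3 ∣ m) {t : ℤ}
    (h : ∃ x : CyclotomicField (3 * m) ℚ, Polynomial.aeval x (shanksPoly t) = 0) :
    ∃ x : CyclotomicField m ℚ, Polynomial.aeval x (shanksPoly t) = 0 := by
  have : NeZero m := ⟨by rintro rfl; simp at hm⟩
  apply exists_root_of_root_cyclotomicField_three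
  set L := CyclotomicField 3 (CyclotomicField m ℚ)
  have : CharZero L := algebraRat.charZero L
  have h3 := IsCyclotomicExtension.zeta_spec 3 (CyclotomicField m ℚ) L
  have hζ := (IsCyclotomicExtension.zeta_spec m ℚ (CyclotomicField m ℚ)).map_of_injective
    (algebraMap (CyclotomicField m ℚ) L).injective
  have hcop : (3 : ℕ).Coprime m := (Nat.Prime.coprime_iff_not_dvd Nat.prime_three).mpr hm
  have hmul := IsPrimitiveRoot.orderOf (IsCyclotomicExtension.zeta 3 (CyclotomicField m ℚ) L *
    algebraMap (CyclotomicField m ℚ) L (IsCyclotomicExtension.zeta m ℚ (CyclotomicField m ℚ)))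
  rw [(Commute.all _ _).orderOf_mul_eq_mul_orderOf_of_coprime
    (by rwa [← h3.eq_orderOf, ← hζ.eq_orderOf]), ← h3.eq_orderOf, ← hζ.eq_orderOf] at hmul
  obtain ⟨g⟩ := nonempty_cyclotomicField_algHom hmul
  obtain ⟨x, hx⟩ := h
  exact ⟨g x, map_root g.toRingHom hx⟩

end Cyclotomic

/-! ### The candidate for the conductor, and the upper bound -/

section Conductor

/-- The primes different from 3 ramifying in `K_t`. -/
def tamePrimes (t : ℤ) : Finset ℕ :=
  (shanksDelta t).natAbs.primeFactors.filter
    fun p => p ≠ 3 ∧ ¬ 3 ∣ (shanksDelta t).natAbs.factorization p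

/-- The part of the conductor of `K_t` prime to 3. -/
def tameConductor (t : ℤ) : ℕ := ∏ p ∈ tamePrimes t, p

/-- The conductor of `K_t`. -/
def shanksConductor (t : ℤ) : ℕ :=
  (if 3 ∣ t ∧ ¬ 27 ∣ t - 12 then 9 else 1) * tameConductor t

theorem natAbs_shanksDelta_ne_zero (t : ℤ) : (shanksDelta t).natAbs ≠ 0 :=
  Int.natAbs_ne_zero.mpr (shanksDelta_pos t).ne'

theorem prime_of_mem_tamePrimes {t : ℤ} {p : ℕ} (h : p ∈ tamePrimes t) : p.Prime :=
  Nat.prime_of_mem_primeFactors (Finset.mem_filter.mp h).1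

theorem tameConductor_ne_zero (t : ℤ) : tameConductor t ≠ 0 :=
  Finset.prod_ne_zero_iff.mpr fun _ h => (prime_of_mem_tamePrimes h).ne_zero

theorem shanksConductor_ne_zero (t : ℤ) : shanksConductor t ≠ 0 :=
  mul_ne_zero (by split_ifs <;> norm_num) (tameConductor_ne_zero t)

theorem prime_dvd_tameConductor {t : ℤ} {p : ℕ} (hp : p.Prime) (h : p ∣ tameConductor t) :
    p ∈ tamePrimes t := by
  obtain ⟨q, hq, hpq⟩ := (Nat.Prime.prime hp).exists_mem_finset_dvd h
  rwa [(Nat.prime_dvd_prime_iff_eq hp (prime_of_mem_tamePrimes hq)).mp hpq]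

theorem not_three_dvd_tameConductor (t : ℤ) : ¬ 3 ∣ tameConductor t := fun h =>
  (Finset.mem_filter.mp (prime_dvd_tameConductor Nat.prime_three h)).2.1 rfl

theorem mem_tamePrimes_of_eq {t : ℤ} {p a : ℕ} {b : ℤ} (hp : p.Prime) (hp3 : p ≠ 3)
    (h : shanksDelta t = p ^ a * b) (hb : ¬ (p : ℤ) ∣ b) (ha : ¬ 3 ∣ a) : p ∈ tamePrimes t := by
  have hn : (shanksDelta t).natAbs = p ^ a * b.natAbs := by
    rw [h, Int.natAbs_mul, Int.natAbs_pow, Int.natAbs_natCast]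
  have hb' : ¬ p ∣ b.natAbs := fun hd => hb (Int.natCast_dvd.mpr hd)
  have hf : (shanksDelta t).natAbs.factorization p = a := by
    rw [hn, Nat.factorization_mul (pow_ne_zero _ hp.ne_zero) (fun h0 => hb' (by rw [h0]; exact dvd_zero _)),
      Finsupp.add_apply, hp.factorization_pow, Finsupp.single_eq_same,
      Nat.factorization_eq_zero_of_not_dvd hb', add_zero]
  have ha0 : a ≠ 0 := fun h0 => ha (h0 ▸ dvd_zero 3)
  rw [tamePrimes, Finset.mem_filter, hf]
  exact ⟨Nat.mem_primeFactors.mpr ⟨hp, hn ▸ (dvd_pow_self p ha0).mul_right _,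
    natAbs_shanksDelta_ne_zero t⟩, hp3, ha⟩

/-- Cardano's formula needs ω. If 9 divides the conductor, ω is present; otherwise it is adjoined
and removed again, the degree being at most 2. -/
theorem exists_root_shanksConductor (t : ℤ) :
    ∃ x : CyclotomicField (shanksConductor t) ℚ, Polynomial.aeval x (shanksPoly t) = 0 := by
  have hn := shanksConductor_ne_zero t
  have : NeZero (shanksConductor t) := ⟨hn⟩
  have hdvd {p a : ℕ} {b : ℤ} (hp : p.Prime) (hp3 : p ≠ 3) (h : shanksDelta t = p ^ a * b)
      (hb : ¬ (p : ℤ) ∣ b) (ha : ¬ 3 ∣ a) : p ∣ shanksConductor t :=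
    (Finset.dvd_prod_of_mem _ (mem_tamePrimes_of_eq hp hp3 h hb ha)).mul_left _
  set n := shanksConductor t with hndef
  have hζ := IsCyclotomicExtension.zeta_spec n ℚ (CyclotomicField n ℚ)
  by_cases h : 3 ∣ t ∧ ¬ 27 ∣ t - 12
  · have h9 : 9 ∣ n := by rw [hndef, shanksConductor, if_pos h]; exact dvd_mul_right _ _
    obtain ⟨ω, hω⟩ := exists_isPrimitiveRoot_of_dvd (Nat.pos_of_ne_zero hn) hζ
      (dvd_trans (by norm_num : 3 ∣ 9) h9)
    exact exists_root_of_primitiveRoots hω (fun p a b hp hp3 hΔ hb ha =>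
      exists_isPrimitiveRoot_of_dvd (Nat.pos_of_ne_zero hn) hζ (hdvd hp hp3 hΔ hb ha))
      (fun _ _ => exists_isPrimitiveRoot_of_dvd (Nat.pos_of_ne_zero hn) hζ h9)
  · apply exists_root_of_root_cyclotomicField_three
    set L := CyclotomicField 3 (CyclotomicField n ℚ)
    have : CharZero L := algebraRat.charZero L
    exact exists_root_of_primitiveRoots
      (IsCyclotomicExtension.zeta_spec 3 (CyclotomicField n ℚ) L) (fun p a b hp hp3 hΔ hb ha =>
        exists_isPrimitiveRoot_of_dvd (Nat.pos_of_ne_zero hn)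
          (hζ.map_of_injective (algebraMap (CyclotomicField n ℚ) L).injective)
          (hdvd hp hp3 hΔ hb ha))
      (fun h1 h2 => absurd ⟨h1, h2⟩ h)

theorem IsSimplestCubic.nonempty_ringHom {K : Type*} [Field K] [NumberField K] {t : ℤ} {θ : K}
    (h : IsSimplestCubic K t θ) {L : Type*} [Field L] [CharZero L]
    (hL : ∃ x : L, Polynomial.aeval x (shanksPoly t) = 0) : Nonempty (K →+* L) := by
  obtain ⟨x, hx⟩ := hL
  have hint : IsIntegral ℚ θ := IsIntegral.of_finite ℚ θ
  have hmin := minpoly_eq_map_shanksPoly (irreducible_map_shanksPoly t) h.root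
  let g : IntermediateField.adjoin ℚ {θ} →ₐ[ℚ] L :=
    (IntermediateField.algHomAdjoinIntegralEquiv ℚ hint).symm ⟨x, by
      rw [Polynomial.mem_aroots]
      refine ⟨minpoly.ne_zero hint, ?_⟩
      rwa [hmin, Polynomial.aeval_map_algebraMap]⟩
  exact ⟨g.toRingHom.comp ((IntermediateField.equivOfEq h.adjoin_eq_top.symm).toAlgHom.comp
    IntermediateField.topEquiv.symm.toAlgHom).toRingHom⟩

theorem IsSimplestCubic.nonempty_ringHom_iff {K : Type*} [Field K] [NumberField K] {t : ℤ} {θ : K}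
    (h : IsSimplestCubic K t θ) {L : Type*} [Field L] [CharZero L] :
    Nonempty (K →+* L) ↔ ∃ x : L, Polynomial.aeval x (shanksPoly t) = 0 :=
  ⟨fun ⟨f⟩ => ⟨f θ, map_root f h.root⟩, h.nonempty_ringHom⟩

theorem IsSimplestCubic.finrank {K : Type*} [Field K] [NumberField K] {t : ℤ} {θ : K}
    (h : IsSimplestCubic K t θ) : Module.finrank ℚ K = 3 := by
  rw [← IntermediateField.finrank_top', ← h.adjoin_eq_top,
    IntermediateField.adjoin.finrank (IsIntegral.of_finite ℚ θ),
    minpoly_eq_map_shanksPoly (irreducible_map_shanksPoly t) h.root,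
    (shanksPoly_monic t).natDegree_map, shanksPoly_natDegree]

end Conductor

/-! ### Indices in abelian groups with an automorphism of order 3 -/

section Group

variable {E : Type*} [CommGroup E]

theorem index_cubes_le {r : ℕ} (g : Fin r → E) (hg : ∀ e : E, ∃ n : Fin r → ℤ, e = ∏ i, g i ^ n i) :
    (powMonoidHom 3 : E →* E).range.index ≤ 3 ^ r ∧ (powMonoidHom 3 : E →* E).range.index ≠ 0 := by
  let R := (powMonoidHom 3 : E →* E).range
  let f : (Fin r → Fin 3) → E ⧸ R := fun n => QuotientGroup.mk (∏ i, g i ^ (n i : ℕ))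
  have hf : Function.Surjective f := by
    intro q
    obtain ⟨e, rfl⟩ := QuotientGroup.mk_surjective q
    obtain ⟨n, rfl⟩ := hg e
    refine ⟨fun i => ⟨(n i % 3).toNat, by omega⟩, ?_⟩
    rw [QuotientGroup.eq]
    refine ⟨∏ i, g i ^ (n i / 3), ?_⟩
    rw [powMonoidHom_apply, ← Finset.prod_pow, ← Finset.prod_inv_distrib, ← Finset.prod_mul_distrib]
    refine Finset.prod_congr rfl fun i _ => ?_
    rw [← zpow_natCast (g i) (n i % 3).toNat, Int.toNat_of_nonneg (by omega), ← zpow_natCast,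
      ← zpow_mul, ← zpow_neg, ← zpow_add]
    congr 1
    push_cast
    omega
  have hfin : Finite (E ⧸ R) := Finite.of_surjective f hf
  refine ⟨?_, Nat.card_pos.ne'⟩
  have := Nat.card_le_card_of_surjective f hf
  rwa [Nat.card_fun, Nat.card_fin, Nat.card_fin] at this

/-- In additive notation 1 + σ + σ² = 0 gives (σ - 1)² = -3σ. As D = σ - 1 is injective, the square
of the index of its image is the index of the cubes, at most 9. -/
theorem index_range_div_le (s : E →* E) (hs : ∀ u, s (s (s u)) = u)
    (hN : ∀ u, u * s u * s (s u) = 1) (htors : ∀ u : E, u ^ 3 = 1 → u = 1)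
    (hc : (powMonoidHom 3 : E →* E).range.index ≤ 9)
    (hc0 : (powMonoidHom 3 : E →* E).range.index ≠ 0) :
    (s / MonoidHom.id E).range.index ≤ 3 ∧ (s / MonoidHom.id E).range.index ≠ 0 := by
  set D := s / MonoidHom.id E with hD
  have hDa (u : E) : D u = s u / u := rfl
  have hinj : Function.Injective D := by
    rw [injective_iff_map_eq_one]
    intro u hu
    rw [hDa, div_eq_one] at hu
    refine htors u ?_
    have := hN u
    rw [hu, hu] at this
    rw [← this, pow_succ, pow_two]
  have hDD (u : E) : D (D u) = (s u)⁻¹ ^ 3 := by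
    rw [hDa, hDa, map_div]
    have := hN u
    have h2 : s (s u) = (u * s u)⁻¹ := eq_inv_of_mul_eq_one_right this
    rw [h2, div_eq_mul_inv, div_eq_mul_inv, div_eq_mul_inv, mul_inv, mul_inv, inv_inv]
    rw [show (s u)⁻¹ ^ 3 = (s u)⁻¹ * (s u)⁻¹ * (s u)⁻¹ by rw [pow_succ, pow_two]]
    calc u⁻¹ * (s u)⁻¹ * (s u)⁻¹ * ((s u)⁻¹ * u) = (s u)⁻¹ * (s u)⁻¹ * (s u)⁻¹ * (u⁻¹ * u) := by
          simp only [mul_comm, mul_assoc, mul_left_comm]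
      _ = _ := by rw [inv_mul_cancel, mul_one]
  have hmap : D.range.map D = (powMonoidHom 3 : E →* E).range := by
    ext x
    simp only [Subgroup.mem_map, MonoidHom.mem_range, powMonoidHom_apply]
    constructor
    · rintro ⟨_, ⟨u, rfl⟩, rfl⟩
      exact ⟨_, (hDD u).symm⟩
    · rintro ⟨u, rfl⟩
      exact ⟨_, ⟨s (s u⁻¹), rfl⟩, by rw [hDD, hs, inv_inv]⟩
  have hidx : D.range.index * D.range.index = (powMonoidHom 3 : E →* E).range.index := by
    rw [← hmap, Subgroup.index_map_of_injective _ hinj]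
  constructor
  · nlinarith
  · intro h0
    rw [h0] at hidx
    exact hc0 hidx.symm

/-- The quotient has order 2 or 3, a prime, so the nontrivial class of v generates it. -/
theorem exists_pow_mul_of_index_le {H : Subgroup E} (hH : H.index ≤ 3) (hH0 : H.index ≠ 0) {v : E}
    (hv : v ∉ H) (w : E) : ∃ i < 3, ∃ h ∈ H, w = v ^ i * h := by
  have hfin : Finite (E ⧸ H) := Nat.finite_of_card_ne_zero hH0
  have hcard : Nat.card (E ⧸ H) = H.index := rfl
  have hv1 : (QuotientGroup.mk v : E ⧸ H) ≠ 1 := fun h => hv ((QuotientGroup.eq_one_iff v).mp h)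
  have hne : H.index ≠ 1 := fun h => by
    rw [h, Nat.card_eq_one_iff_unique] at hcard
    have := hcard.1
    exact hv1 (Subsingleton.elim _ _)
  have hp : H.index.Prime := by
    interval_cases H.index
    · exact absurd rfl hH0
    · exact absurd rfl hne
    · exact Nat.prime_two
    · exact Nat.prime_three
  have := Fact.mk hp
  have hmem := mem_zpowers_of_prime_card hcard hv1 (g' := (QuotientGroup.mk w : E ⧸ H))
  classical
  obtain ⟨i, hi, hi'⟩ := Finset.mem_image.mp (mem_zpowers_iff_mem_range_orderOf.mp hmem)
  refine ⟨i, ?_, (v ^ i)⁻¹ * w, ?_, by rw [mul_inv_cancel_left]⟩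
  · have h1 := orderOf_le_card (x := (QuotientGroup.mk v : E ⧸ H))
    rw [hcard] at h1
    have := Finset.mem_range.mp hi
    omega
  · rw [← QuotientGroup.eq]
    exact hi'

end Group

/-! ### Units of norm one modulo the quotients σe/e -/

section Units

open NumberField NumberField.Units

variable {K : Type*} [Field K] [NumberField K]

theorem rank_le_two (hK : Module.finrank ℚ K = 3) : rank K ≤ 2 := by
  have h1 := InfinitePlace.card_add_two_mul_card_eq_rank K
  have h2 := InfinitePlace.card_eq_nrRealPlaces_add_nrComplexPlaces K
  rw [rank]
  omega

theorem exists_pow_mul_div_of_norm_one (hK : Module.finrank ℚ K = 3) (s : (𝓞 K)ˣ →* (𝓞 K)ˣ)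
    (hs : ∀ u, s (s (s u)) = u) (hN : ∀ u, u * s u * s (s u) = 1 ∨ u * s u * s (s u) = -1)
    {v w : (𝓞 K)ˣ} (hv : v * s v * s (s v) = 1) (hw : w * s w * s (s w) = 1)
    (hv' : ∀ e, v ≠ s e / e) : ∃ i < 3, ∃ e, w = v ^ i * (s e / e) := by
  have hodd : Odd (Module.finrank ℚ K) := by rw [hK]; decide
  let N : (𝓞 K)ˣ →* (𝓞 K)ˣ := MonoidHom.id _ * s * s.comp s
  have hNa (u) : N u = u * s u * s (s u) := rfl
  have hNs (u) : N (s u) = N u := by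
    rw [hNa, hNa, hs, mul_comm, mul_assoc]
  have hs1 : s (-1) = -1 := by
    have h1 : s (-1) ^ 2 = 1 := by rw [← map_pow]; simp
    have hmem : s (-1) ∈ torsion K :=
      (CommGroup.mem_torsion _).mpr (isOfFinOrder_iff_pow_eq_one.mpr ⟨2, by norm_num, h1⟩)
    rcases torsion_eq_one_or_neg_one_of_odd_finrank hodd ⟨_, hmem⟩ with h | h
    · simp only at h
      have := hs (-1)
      rw [h, map_one, map_one] at this
      rw [h, ← this]
    · exact h
  have hN1 : N (-1) = -1 := by rw [hNa, hs1, hs1]; simp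
  let E := N.ker
  let sE : E →* E := (s.comp E.subtype).codRestrict E fun u => by
    rw [MonoidHom.mem_ker]
    simp only [MonoidHom.comp_apply]
    rw [hNs]; exact u.2
  have hsE (u : E) : ((sE u : E) : (𝓞 K)ˣ) = s u := rfl
  have htors (u : E) (hu : u ^ 3 = 1) : u = 1 := by
    have hu' : (u : (𝓞 K)ˣ) ^ 3 = 1 := by exact_mod_cast congrArg Subtype.val hu
    have hmem : (u : (𝓞 K)ˣ) ∈ torsion K :=
      (CommGroup.mem_torsion _).mpr (isOfFinOrder_iff_pow_eq_one.mpr ⟨3, by norm_num, hu'⟩)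
    rcases torsion_eq_one_or_neg_one_of_odd_finrank hodd ⟨_, hmem⟩ with h | h
    · exact Subtype.ext h
    · simp only at h
      have h2 : N u = 1 := u.2
      rw [h, hN1] at h2
      exact Subtype.ext (h.trans h2)
  have hNsq (u : (𝓞 K)ˣ) : N (N u * u) = 1 := by
    rcases hN u with h | h <;> rw [← hNa] at h
    · rw [h, one_mul, h]
    · rw [map_mul, h, hN1]; simp
  -- Since N(-1) = -1, the sign N(ε) turns a fundamental unit ε into a unit of norm 1. These
  -- generate E: the only torsion is ±1, and -1 has norm -1.
  let g : Fin (rank K) → E := fun i => ⟨N (fundSystem K i) * fundSystem K i, hNsq _⟩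
  obtain ⟨hc, hc0⟩ := index_cubes_le g fun e => by
    obtain ⟨⟨ζ, n⟩, hn, -⟩ := exist_unique_eq_mul_prod K (e : (𝓞 K)ˣ)
    refine ⟨n, ?_⟩
    set P : E := ∏ i, g i ^ n i with hP
    have hPval : (P : (𝓞 K)ˣ) = N (∏ i, fundSystem K i ^ n i) * ∏ i, fundSystem K i ^ n i := by
      rw [hP, map_prod, ← Finset.prod_mul_distrib, Subgroup.val_finsetProd]
      refine Finset.prod_congr rfl fun i _ => ?_
      rw [map_zpow, ← mul_zpow]
      rfl
    have heP : ∃ c : (𝓞 K)ˣ, (c = 1 ∨ c = -1) ∧ (e : (𝓞 K)ˣ) = c * P := by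
      set Q := ∏ i, fundSystem K i ^ n i
      have hζ := torsion_eq_one_or_neg_one_of_odd_finrank hodd ζ
      rcases hN Q with h | h <;> rw [← hNa] at h
      · exact ⟨ζ, hζ, by rw [hPval, h, one_mul]; exact hn⟩
      · refine ⟨-ζ, ?_, by rw [hPval, h, neg_one_mul, neg_mul_neg]; exact hn⟩
        rcases hζ with h' | h' <;> rw [h'] <;> simp
    obtain ⟨c, hc, hec⟩ := heP
    rcases hc with rfl | rfl
    · exact Subtype.ext (by rw [hec, one_mul])
    · exfalso
      have h1 : N e = 1 := e.2
      have h2 : N P = 1 := P.2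
      rw [hec, map_mul, hN1, h2, mul_one] at h1
      have h3 : ((-1 : (𝓞 K)ˣ) : 𝓞 K) = 1 := by rw [h1]; rfl
      rw [Units.val_neg, Units.val_one] at h3
      have h4 : ((2 : ℕ) : 𝓞 K) = 0 := by push_cast; linear_combination -h3
      norm_num at h4
  obtain ⟨hI, hI0⟩ := index_range_div_le sE (fun u => Subtype.ext (hs u))
    (fun u => Subtype.ext u.2) htors
    (hc.trans ((Nat.pow_le_pow_right (by norm_num) (rank_le_two hK)).trans (by norm_num))) hc0
  obtain ⟨i, hi, _, ⟨e, rfl⟩, he⟩ := exists_pow_mul_of_index_le hI hI0 (v := ⟨v, hv⟩)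
    (by rintro ⟨e, he⟩; exact hv' e (congrArg Subtype.val he).symm) ⟨w, hw⟩
  exact ⟨i, hi, e, congrArg Subtype.val he⟩

end Units

/-! ### Galois action on the simplest cubic field -/

namespace IsSimplestCubic

section Galois

variable {K : Type*} [Field K] [NumberField K] {t : ℤ} {θ : K}

theorem eq_zero (h : IsSimplestCubic K t θ) : θ ^ 3 - t * θ ^ 2 - (t + 3) * θ - 1 = 0 := by
  rw [← aeval_shanksPoly, h.root]

theorem ne_zero (h : IsSimplestCubic K t θ) : θ ≠ 0 := fun h0 => by
  have := h.eq_zero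
  rw [h0] at this
  simp at this

theorem one_add_ne_zero (h : IsSimplestCubic K t θ) : 1 + θ ≠ 0 := fun h0 => by
  have := h.eq_zero
  rw [show θ = -1 by linear_combination h0] at this
  ring_nf at this
  simp at this

-- The map x ↦ -1/(1 + x) has order 3 and permutes the roots, so one root yields all of them.
open Polynomial in
theorem map_shanksPoly_eq (h : IsSimplestCubic K t θ) :
    (shanksPoly t).map (algebraMap ℤ K) =
      (X - C θ) * (X - C (-1 / (1 + θ))) * (X - C (-(1 + θ) / θ)) := by
  have h0 := h.ne_zero
  have h1 := h.one_add_ne_zero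
  have e := h.eq_zero
  have e1 : (t : K) = θ + -1 / (1 + θ) + -(1 + θ) / θ := by
    field_simp; linear_combination -e
  have e2 : -((t : K) + 3) = θ * (-1 / (1 + θ)) + θ * (-(1 + θ) / θ) +
      -1 / (1 + θ) * (-(1 + θ) / θ) := by
    field_simp; linear_combination e
  have e3 : (1 : K) = θ * (-1 / (1 + θ)) * (-(1 + θ) / θ) := by field_simp
  have : (shanksPoly t).map (algebraMap ℤ K) =
      X ^ 3 - C (t : K) * X ^ 2 + C (-((t : K) + 3)) * X - C 1 := by
    rw [shanksPoly_eq]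
    simp [map_ofNat C 3]
    ring
  rw [this, e2]
  set b := -1 / (1 + θ)
  set c := -(1 + θ) / θ
  rw [e1, e3]
  simp only [map_add, map_mul]
  ring

open Polynomial in
theorem isGalois (h : IsSimplestCubic K t θ) : IsGalois ℚ K := by
  have hmap : ((shanksPoly t).map (algebraMap ℤ ℚ)).map (algebraMap ℚ K) =
      (shanksPoly t).map (algebraMap ℤ K) := by
    rw [Polynomial.map_map]; congr 1; exact RingHom.ext_int _ _
  have : IsSplittingField ℚ K ((shanksPoly t).map (algebraMap ℤ ℚ)) := by
    refine ⟨?_, ?_⟩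
    · rw [hmap, h.map_shanksPoly_eq]
      exact ((Splits.X_sub_C _).mul (Splits.X_sub_C _)).mul (Splits.X_sub_C _)
    · rw [eq_top_iff, ← IntermediateField.top_toSubalgebra, ← h.adjoin_eq_top,
        IntermediateField.adjoin_simple_toSubalgebra_of_isAlgebraic
          (Algebra.IsAlgebraic.isAlgebraic θ)]
      refine Algebra.adjoin_mono ?_
      rw [Set.singleton_subset_iff, mem_rootSet]
      refine ⟨((shanksPoly_monic t).map _).ne_zero, ?_⟩
      rw [aeval_map_algebraMap, h.root]
  exact IsGalois.of_separable_splitting_field (irreducible_map_shanksPoly t).separable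

variable {σ : K ≃ₐ[ℚ] K}

theorem card_gal (h : IsSimplestCubic K t θ) : Nat.card (K ≃ₐ[ℚ] K) = 3 := by
  have := h.isGalois
  rw [IsGalois.card_aut_eq_finrank, h.finrank]

theorem orderOf_eq (h : IsSimplestCubic K t θ) (hσ : Subgroup.zpowers σ = ⊤) : orderOf σ = 3 := by
  rw [← Nat.card_zpowers, hσ, Subgroup.card_top, h.card_gal]

theorem apply_apply_apply (h : IsSimplestCubic K t θ) (hσ : Subgroup.zpowers σ = ⊤) (x : K) :
    σ (σ (σ x)) = x := by
  have := pow_orderOf_eq_one σ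
  rw [h.orderOf_eq hσ] at this
  exact DFunLike.congr_fun this x

theorem exists_rat_of_fixed (h : IsSimplestCubic K t θ) (hσ : Subgroup.zpowers σ = ⊤) {x : K}
    (hx : σ x = x) : ∃ q : ℚ, x = q := by
  have := h.isGalois
  have hb : x ∈ (⊥ : IntermediateField ℚ K) := by
    rw [IsGalois.mem_bot_iff_fixed]
    intro f
    have hf : f ∈ Subgroup.zpowers σ := hσ ▸ Subgroup.mem_top f
    have hle : Subgroup.zpowers σ ≤ MulAction.stabilizer (K ≃ₐ[ℚ] K) x := by
      rw [Subgroup.zpowers_le]; exact hx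
    exact hle hf
  obtain ⟨q, hq⟩ := IntermediateField.mem_bot.mp hb
  exact ⟨q, by rw [← hq]; simp⟩

theorem apply_ne (h : IsSimplestCubic K t θ) (hσ : Subgroup.zpowers σ = ⊤) : σ θ ≠ θ := fun hf => by
  obtain ⟨q, hq⟩ := h.exists_rat_of_fixed hσ hf
  refine aeval_shanksPoly_rat_ne_zero t q ?_
  have := h.root
  rw [aeval_shanksPoly, hq] at this
  rw [aeval_shanksPoly]
  exact_mod_cast this

theorem apply_eq_or (h : IsSimplestCubic K t θ) (hσ : Subgroup.zpowers σ = ⊤) :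
    (σ θ + θ * σ θ + 1 = 0) ∨ (θ * σ θ + θ + 1 = 0) := by
  have hr : Polynomial.aeval (σ θ) (shanksPoly t) = 0 := map_root (σ : K →+* K) h.root
  rw [← isRoot_map_shanksPoly, h.map_shanksPoly_eq] at hr
  simp only [Polynomial.IsRoot, Polynomial.eval_mul, Polynomial.eval_sub, Polynomial.eval_X,
    Polynomial.eval_C, mul_eq_zero, sub_eq_zero] at hr
  rcases hr with (hr | hr) | hr
  · exact absurd hr (h.apply_ne hσ)
  · left
    rw [eq_div_iff h.one_add_ne_zero] at hr
    linear_combination hr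
  · right
    rw [eq_div_iff h.ne_zero] at hr
    linear_combination hr

theorem isIntegral (h : IsSimplestCubic K t θ) : IsIntegral ℤ θ :=
  ⟨shanksPoly t, shanksPoly_monic t, by rw [← Polynomial.aeval_def, h.root]⟩

end Galois

/-! ### The element θ - σθ and the principal ambiguous ideals -/

section Units

open NumberField NumberField.Units

variable {K : Type*} [Field K] [NumberField K] {t : ℤ} {θ : K} {σ : K ≃ₐ[ℚ] K}

/-- The action of `σ` on the ring of integers. -/
noncomputable abbrev galInt (σ : K ≃ₐ[ℚ] K) : 𝓞 K ≃+* 𝓞 K :=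
  RingOfIntegers.mapRingEquiv (σ : K ≃+* K)

theorem galInt_cube (h : IsSimplestCubic K t θ) (hσ : Subgroup.zpowers σ = ⊤) (x : 𝓞 K) :
    galInt σ (galInt σ (galInt σ x)) = x :=
  RingOfIntegers.ext (h.apply_apply_apply hσ x)

/-- `θ - σ θ` as an algebraic integer. -/
noncomputable def delta (h : IsSimplestCubic K t θ) (σ : K ≃ₐ[ℚ] K) : 𝓞 K :=
  ⟨θ, h.isIntegral⟩ - galInt σ ⟨θ, h.isIntegral⟩

theorem coe_delta (h : IsSimplestCubic K t θ) : (h.delta σ : K) = θ - σ θ := rfl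

theorem delta_ne_zero (h : IsSimplestCubic K t θ) (hσ : Subgroup.zpowers σ = ⊤) :
    h.delta σ ≠ 0 := fun h0 => by
  have : θ - σ θ = 0 := congrArg (algebraMap (𝓞 K) K) h0
  exact h.apply_ne hσ (sub_eq_zero.mp this).symm

theorem symmetric (h : IsSimplestCubic K t θ) (hσ : Subgroup.zpowers σ = ⊤) :
    θ + σ θ + σ (σ θ) = t ∧ θ * σ θ + σ θ * σ (σ θ) + σ (σ θ) * θ = -(t + 3) ∧
      θ * σ θ * σ (σ θ) = 1 := by
  have e := h.eq_zero
  have h0 := h.ne_zero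
  have h1 := h.one_add_ne_zero
  have hc := h.apply_apply_apply hσ θ
  rcases h.apply_eq_or hσ with hb | hb
  · have hb2 := congrArg σ (congrArg σ hb)
    simp only [map_add, map_mul, map_one, map_zero, hc] at hb2
    have eb : σ θ = -1 / (1 + θ) := by rw [eq_div_iff h1]; linear_combination hb
    have ec : σ (σ θ) = -(1 + θ) / θ := by rw [eq_div_iff h0]; linear_combination hb2
    rw [ec, eb]
    refine ⟨?_, ?_, ?_⟩
    · field_simp; linear_combination e
    · field_simp; linear_combination -e
    · field_simp
  · have hb2 := congrArg σ (congrArg σ hb)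
    simp only [map_add, map_mul, map_one, map_zero, hc] at hb2
    have eb : σ θ = -(1 + θ) / θ := by rw [eq_div_iff h0]; linear_combination hb
    have ec : σ (σ θ) = -1 / (1 + θ) := by rw [eq_div_iff h1]; linear_combination hb2
    rw [ec, eb]
    refine ⟨?_, ?_, ?_⟩
    · field_simp; linear_combination e
    · field_simp; linear_combination -e
    · field_simp

/-- The conjugates a, b, c of θ are units with product 1. Subtracting conjugates of the relation
between θ and σθ exhibits b - c as a - b times bc or c, depending on which generator σ is. -/
theorem exists_galInt_delta (h : IsSimplestCubic K t θ) (hσ : Subgroup.zpowers σ = ⊤) :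
    ∃ u : (𝓞 K)ˣ, galInt σ (h.delta σ) = u * h.delta σ := by
  set a : 𝓞 K := ⟨θ, h.isIntegral⟩ with ha
  set b := galInt σ a with hbdef
  set c := galInt σ b with hcdef
  have habc : a * b * c = 1 := RingOfIntegers.ext (h.symmetric hσ).2.2
  have hsc : galInt σ c = a := h.galInt_cube hσ a
  have hd : galInt σ (h.delta σ) = b - c := by
    change galInt σ (a - b) = _
    rw [map_sub]
  rw [hd]
  change ∃ u : (𝓞 K)ˣ, b - c = u * (a - b)
  have hc : IsUnit c := IsUnit.of_mul_eq_one (a * b) (by rw [mul_comm]; exact habc)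
  have hb : IsUnit b := IsUnit.of_mul_eq_one (a * c) (by linear_combination habc)
  rcases h.apply_eq_or hσ with hr | hr
  · have r1 : b + a * b + 1 = 0 := RingOfIntegers.ext hr
    have r2 := congrArg (galInt σ) r1
    rw [map_add, map_add, map_mul, map_one, map_zero, ← hbdef, ← hcdef] at r2
    have r3 := congrArg (galInt σ) r2
    rw [map_add, map_add, map_mul, map_one, map_zero, hsc, ← hcdef] at r3
    exact ⟨hb.unit * hc.unit, by
      simp only [Units.val_mul, IsUnit.unit_spec]; linear_combination r1 - r2 - b * (r3 - r2)⟩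
  · have r1 : a * b + a + 1 = 0 := RingOfIntegers.ext hr
    have r2 := congrArg (galInt σ) r1
    rw [map_add, map_add, map_mul, map_one, map_zero, ← hbdef, ← hcdef] at r2
    have r3 := congrArg (galInt σ) r2
    rw [map_add, map_add, map_mul, map_one, map_zero, hsc, ← hcdef] at r3
    exact ⟨hc.unit, by simp only [IsUnit.unit_spec]; linear_combination r2 - r3⟩

/-- `(θ - σ θ)³ = (Δ_t)`. -/
theorem exists_delta_cube (h : IsSimplestCubic K t θ) (hσ : Subgroup.zpowers σ = ⊤) :
    ∃ u : (𝓞 K)ˣ, h.delta σ ^ 3 = u * (shanksDelta t : 𝓞 K) := by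
  obtain ⟨u, hu⟩ := h.exists_galInt_delta hσ
  set s := galInt σ
  set d := h.delta σ
  have hu' : IsUnit (s u) := u.isUnit.map s
  have hN : d * s d * s (s d) = (shanksDelta t : 𝓞 K) ∨
      d * s d * s (s d) = -(shanksDelta t : 𝓞 K) := by
    rw [← sq_eq_sq_iff_eq_or_eq_neg]
    apply RingOfIntegers.ext
    obtain ⟨e1, e2, e3⟩ := h.symmetric hσ
    have hc := h.apply_apply_apply hσ θ
    have k1 : ((s d : 𝓞 K) : K) = σ θ - σ (σ θ) := by
      change σ (θ - σ θ) = _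
      rw [map_sub]
    have k2 : ((s (s d) : 𝓞 K) : K) = σ (σ θ) - θ := by
      change σ (s d : 𝓞 K) = _
      rw [k1, map_sub, hc]
    change algebraMap (𝓞 K) K ((d * s d * s (s d)) ^ 2) =
      algebraMap (𝓞 K) K ((shanksDelta t : 𝓞 K) ^ 2)
    rw [map_pow, map_mul, map_mul, map_pow, map_intCast]
    change ((d : K) * (s d : 𝓞 K) * (s (s d) : 𝓞 K)) ^ 2 = _
    rw [k1, k2, coe_delta]
    set b := σ θ
    set c := σ b
    set a := θ
    -- The discriminant in terms of symmetric functions; for `f_t` it equals `Δ_t²`.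
    have hdisc : ((a - b) * (b - c) * (c - a)) ^ 2 =
        18 * (a + b + c) * (a * b + b * c + c * a) * (a * b * c) - 4 * (a + b + c) ^ 3 * (a * b * c)
        + (a + b + c) ^ 2 * (a * b + b * c + c * a) ^ 2 - 4 * (a * b + b * c + c * a) ^ 3 -
        27 * (a * b * c) ^ 2 := by ring
    rw [hdisc, e1, e2, e3, shanksDelta]
    push_cast
    ring
  have hprod : d * s d * s (s d) = u * (s u * u) * d ^ 3 := by
    rw [hu, map_mul, hu]; ring
  have hv : IsUnit ((u : 𝓞 K) * (s u * u)) := u.isUnit.mul (hu'.mul u.isUnit)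
  obtain ⟨v, hv⟩ := hv
  rw [hprod, ← hv] at hN
  rcases hN with hN | hN
  · exact ⟨v⁻¹, by rw [← hN, Units.inv_mul_cancel_left]⟩
  · refine ⟨-v⁻¹, ?_⟩
    rw [Units.val_neg, neg_mul, ← mul_neg, ← hN, Units.inv_mul_cancel_left]

theorem norm_unit (h : IsSimplestCubic K t θ) (hσ : Subgroup.zpowers σ = ⊤) (u : (𝓞 K)ˣ) :
    (u : 𝓞 K) * galInt σ u * galInt σ (galInt σ u) = 1 ∨
      (u : 𝓞 K) * galInt σ u * galInt σ (galInt σ u) = -1 := by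
  set x : 𝓞 K := (u : 𝓞 K) * galInt σ u * galInt σ (galInt σ u) with hx
  have hxu : IsUnit x := (u.isUnit.mul (u.isUnit.map _)).mul ((u.isUnit.map _).map _)
  have hfix : galInt σ x = x := by
    rw [hx, map_mul, map_mul, h.galInt_cube hσ]; ring
  obtain ⟨q, hq⟩ := h.exists_rat_of_fixed hσ (congrArg (algebraMap (𝓞 K) K) hfix)
  have hint : IsIntegral ℤ q := by
    have : IsIntegral ℤ (x : K) := x.isIntegral_coe
    rw [hq, ← eq_ratCast (algebraMap ℚ K) q] at this
    exact (isIntegral_algebraMap_iff (algebraMap ℚ K).injective).mp this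
  obtain ⟨n, rfl⟩ := IsIntegrallyClosed.isIntegral_iff.mp hint
  have hxn : x = n := RingOfIntegers.ext (by rw [hq]; simp)
  rw [hxn] at hxu ⊢
  have hn : IsUnit n := by
    have := (NumberField.isUnit_iff_norm).mp hxu
    simp only [RingOfIntegers.coe_norm, map_intCast] at this
    have h2 : Algebra.norm ℚ ((n : ℤ) : K) = (n : ℚ) ^ 3 := by
      have := Algebra.norm_algebraMap (R := ℚ) (S := K) (n : ℚ)
      rw [h.finrank] at this
      simpa using this
    rw [h2, abs_pow] at this
    have h3 : |(n : ℚ)| = 1 := (pow_eq_one_iff_of_nonneg (abs_nonneg _) (by norm_num)).mp this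
    rw [Int.isUnit_iff_abs_eq]
    exact_mod_cast h3
  rcases Int.isUnit_iff.mp hn with rfl | rfl <;> simp

/-- The principal ambiguous ideals are generated by `θ - σ θ` and the rational numbers, provided
that `θ - σ θ` is not the product of a rational number and a unit. -/
theorem exists_eq_mul_delta_pow (h : IsSimplestCubic K t θ) (hσ : Subgroup.zpowers σ = ⊤)
    (hd : ∀ (q : ℚ) (e : (𝓞 K)ˣ), (h.delta σ : K) ≠ q * (e : 𝓞 K)) {α : 𝓞 K} (hα : α ≠ 0)
    {w : (𝓞 K)ˣ} (hw : galInt σ α = w * α) :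
    ∃ i < 3, ∃ (q : ℚ) (e : (𝓞 K)ˣ), (α : K) = q * (e : 𝓞 K) * (h.delta σ : K) ^ i := by
  obtain ⟨v, hv⟩ := h.exists_galInt_delta hσ
  have hd0 := h.delta_ne_zero hσ
  let s : (𝓞 K)ˣ →* (𝓞 K)ˣ := Units.map (galInt σ : 𝓞 K →* 𝓞 K)
  have hs (u : (𝓞 K)ˣ) : ((s u : (𝓞 K)ˣ) : 𝓞 K) = galInt σ u := rfl
  have hnorm {β : 𝓞 K} (hβ : β ≠ 0) {x : (𝓞 K)ˣ} (hx : galInt σ β = x * β) :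
      x * s x * s (s x) = 1 := by
    apply Units.ext
    apply mul_right_cancel₀ hβ
    have h1 := h.galInt_cube hσ β
    rw [hx, map_mul, map_mul, hx, map_mul, hx] at h1
    simp only [Units.val_mul, Units.val_one, hs]
    rw [one_mul]
    linear_combination h1
  -- If x = σe/e, then β/e is fixed by σ, hence rational.
  have key {β : 𝓞 K} (hβ : β ≠ 0) {x e : (𝓞 K)ˣ} (hx : galInt σ β = x * β) (hxe : x = s e / e) :
      ∃ q : ℚ, (β : K) = q * (e : 𝓞 K) := by
    have he0 : ((e : 𝓞 K) : K) ≠ 0 := by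
      rw [Ne, RingOfIntegers.coe_eq_zero_iff]; exact e.ne_zero
    have hfix : σ ((β : K) / (e : 𝓞 K)) = (β : K) / (e : 𝓞 K) := by
      have hse0 : σ ((e : 𝓞 K) : K) ≠ 0 := by simp [he0]
      rw [map_div₀, div_eq_div_iff hse0 he0]
      have h1 : galInt σ β * e = β * galInt σ e := by
        rw [eq_div_iff_mul_eq'] at hxe
        rw [hx, ← hs, ← hxe]; push_cast; ring
      exact congrArg (algebraMap (𝓞 K) K) h1
    obtain ⟨q, hq⟩ := h.exists_rat_of_fixed hσ hfix
    exact ⟨q, by rw [← hq]; field_simp⟩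
  obtain ⟨i, hi, e, hwe⟩ := exists_pow_mul_div_of_norm_one h.finrank s
    (fun u => Units.ext (h.galInt_cube hσ u))
    (fun u => by
      rcases h.norm_unit hσ u with h1 | h1
      · exact .inl (Units.ext h1)
      · exact .inr (Units.ext h1))
    (hnorm hd0 hv) (hnorm hα hw) (fun e he => by
      obtain ⟨q, hq⟩ := key hd0 hv he
      exact hd q e hq)
  have hmul : galInt σ α * (h.delta σ ^ i * e) = α * (galInt σ (h.delta σ) ^ i * galInt σ e) := by
    rw [mul_div_assoc', eq_div_iff_mul_eq'] at hwe
    have h1 := congrArg Units.val hwe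
    simp only [Units.val_mul, Units.val_pow_eq_pow_val, hs] at h1
    rw [hw, hv]
    linear_combination α * h.delta σ ^ i * h1
  have hne : (h.delta σ : K) ^ i * (e : 𝓞 K) ≠ 0 := by
    refine mul_ne_zero (pow_ne_zero _ ?_) ?_
    · rwa [Ne, RingOfIntegers.coe_eq_zero_iff]
    · rw [Ne, RingOfIntegers.coe_eq_zero_iff]; exact e.ne_zero
  have hne' : σ ((h.delta σ : K) ^ i * (e : 𝓞 K)) ≠ 0 := (map_ne_zero σ).mpr hne
  obtain ⟨q, hq⟩ := h.exists_rat_of_fixed hσ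
    (x := (α : K) / ((h.delta σ : K) ^ i * (e : 𝓞 K))) (by
      rw [map_div₀, div_eq_div_iff hne' hne, map_mul, map_pow]
      have h1 := congrArg (algebraMap (𝓞 K) K) hmul
      rw [map_mul, map_mul, map_mul, map_mul, map_pow, map_pow] at h1
      exact h1)
  refine ⟨i, hi, q, e, ?_⟩
  rw [div_eq_iff hne] at hq
  rw [hq]
  ring

end Units

end IsSimplestCubic

/-! ### Total ramification and the lower bound for the conductor -/

section Ramification

open NumberField

variable {K : Type*} [Field K] [NumberField K]

theorem absNorm_span_natCast (hK : Module.finrank ℚ K = 3) (n : ℕ) :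
    Ideal.absNorm (Ideal.span {(n : 𝓞 K)}) = n ^ 3 := by
  rw [Ideal.absNorm_span_singleton]
  have : (n : 𝓞 K) = algebraMap ℤ (𝓞 K) n := by simp
  rw [this, Algebra.norm_algebraMap, RingOfIntegers.rank, hK, Int.natAbs_pow, Int.natAbs_natCast]

/-- With e the exponent of P in (p), comparing exponents gives 3 v(x) = a e, so 3 ∣ e. In degree 3
this leaves only total ramification. -/
theorem cube_eq_span_of_cube_eq (hK : Module.finrank ℚ K = 3) {p : ℕ} (hp : p.Prime)
    {P : Ideal (𝓞 K)} [hP : P.IsPrime] (hpP : (p : 𝓞 K) ∈ P) {a : ℕ} (ha : ¬ 3 ∣ a) {x z : 𝓞 K}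
    (hz : z ∉ P) (h : x ^ 3 = p ^ a * z) :
    P ^ 3 = Ideal.span {(p : 𝓞 K)} ∧ Ideal.absNorm P = p := by
  have hp0 : (p : 𝓞 K) ≠ 0 := Nat.cast_ne_zero.mpr hp.ne_zero
  have hbot : P ≠ ⊥ := fun hb => hp0 (by rw [hb] at hpP; exact hpP)
  have hPp : Prime P := Ideal.prime_of_isPrime hbot hP
  have hfin : FiniteMultiplicity P (Ideal.span {(p : 𝓞 K)}) :=
    FiniteMultiplicity.of_prime_left hPp (by
      rw [Submodule.zero_eq_bot, Ne, Ideal.span_singleton_eq_bot]; exact hp0)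
  have hx0 : x ≠ 0 := fun h0 => by
    rw [h0] at h
    have : (p : 𝓞 K) ^ a * z = 0 := by rw [← h]; ring
    rcases mul_eq_zero.mp this with h1 | h1
    · exact pow_ne_zero a hp0 h1
    · exact hz (h1 ▸ P.zero_mem)
  have hfinx : FiniteMultiplicity P (Ideal.span {x}) :=
    FiniteMultiplicity.of_prime_left hPp (by
      rw [Submodule.zero_eq_bot, Ne, Ideal.span_singleton_eq_bot]; exact hx0)
  have e1 : Ideal.span {x} ^ 3 = Ideal.span {(p : 𝓞 K)} ^ a * Ideal.span {z} := by
    rw [Ideal.span_singleton_pow, Ideal.span_singleton_pow, Ideal.span_singleton_mul_span_singleton, h]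
  have e2 := congrArg (emultiplicity P) e1
  have hz' : emultiplicity P (Ideal.span {z}) = 0 := by
    rwa [emultiplicity_eq_zero, Ideal.dvd_span_singleton]
  rw [emultiplicity_pow hPp, emultiplicity_mul hPp, emultiplicity_pow hPp, hz', add_zero,
    hfin.emultiplicity_eq_multiplicity, hfinx.emultiplicity_eq_multiplicity] at e2
  set e := multiplicity P (Ideal.span {(p : 𝓞 K)})
  have e3 : 3 * multiplicity P (Ideal.span {x}) = a * e := by exact_mod_cast e2
  have h3e : 3 ∣ e := by
    have : 3 ∣ a * e := ⟨_, e3.symm⟩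
    exact ((Nat.Prime.dvd_mul Nat.prime_three).mp this).resolve_left ha
  have he0 : e ≠ 0 := fun h0 => by
    have := (hfin.pow_dvd_iff_le_multiplicity (k := 1)).mp (by
      rw [pow_one]; exact Ideal.dvd_span_singleton.mpr hpP)
    omega
  have hdvd : P ^ 3 ∣ Ideal.span {(p : 𝓞 K)} :=
    hfin.pow_dvd_iff_le_multiplicity.mpr (Nat.le_of_dvd (Nat.pos_of_ne_zero he0) h3e)
  obtain ⟨C, hC⟩ := hdvd
  -- From (p) = P³C, taking norms gives p³ = N(P)³ N(C) with p ∣ N(P); hence N(P) = p and C = (1).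
  have hN := congrArg Ideal.absNorm hC
  rw [absNorm_span_natCast hK, map_mul, map_pow] at hN
  obtain ⟨f, -, hf⟩ := (Nat.dvd_prime_pow hp).mp
    ((dvd_pow_self _ (by norm_num : (3 : ℕ) ≠ 0)).trans (Dvd.intro _ hN.symm))
  have hf0 : f ≠ 0 := fun h0 => by
    rw [h0, pow_zero, Ideal.absNorm_eq_one_iff] at hf
    exact hP.ne_top hf
  obtain ⟨g, rfl⟩ := Nat.exists_eq_add_one_of_ne_zero hf0
  have hone : p ^ (3 * g) * Ideal.absNorm C = 1 := by
    apply Nat.eq_of_mul_eq_mul_left (Nat.pow_pos (n := 3) hp.pos)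
    rw [mul_one]
    nth_rewrite 2 [hN]
    rw [hf]; ring
  have h1 := Nat.eq_one_of_mul_eq_one_right hone
  have h2 := Nat.eq_one_of_mul_eq_one_left hone
  rw [Ideal.absNorm_eq_one_iff] at h2
  have hg : g = 0 := by
    by_contra hg
    have := Nat.one_lt_pow (by omega : 3 * g ≠ 0) hp.one_lt
    omega
  refine ⟨by rw [hC, h2, Ideal.mul_top], by rw [hf, hg, zero_add, pow_one]⟩

omit [NumberField K] in
theorem intCast_notMem {p : ℕ} {P : Ideal (𝓞 K)} [hP : P.IsPrime]
    (hpP : (p : 𝓞 K) ∈ P) {b : ℤ} (hb : IsCoprime (p : ℤ) b) : (b : 𝓞 K) ∉ P := fun h => by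
  obtain ⟨u, v, huv⟩ := hb
  apply hP.one_notMem
  rw [← Int.cast_one, ← huv]
  push_cast
  exact P.add_mem (P.mul_mem_left _ hpP) (P.mul_mem_left _ h)

namespace IsSimplestCubic

variable {t : ℤ} {θ : K} {σ : K ≃ₐ[ℚ] K}

theorem cube_eq_span_of_eq (h : IsSimplestCubic K t θ) (hσ : Subgroup.zpowers σ = ⊤)
    {p : ℕ} (hp : p.Prime) {P : Ideal (𝓞 K)} [P.IsPrime] (hpP : (p : 𝓞 K) ∈ P)
    {a : ℕ} {b : ℤ} (hab : shanksDelta t = p ^ a * b) (hb : ¬ (p : ℤ) ∣ b) (ha : ¬ 3 ∣ a) :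
    P ^ 3 = Ideal.span {(p : 𝓞 K)} ∧ Ideal.absNorm P = p := by
  obtain ⟨u, hu⟩ := h.exists_delta_cube hσ
  refine cube_eq_span_of_cube_eq h.finrank hp hpP ha (z := u * b) ?_ (x := h.delta σ) ?_
  · rw [Ideal.unit_mul_mem_iff_mem P u.isUnit]
    exact intCast_notMem hpP ((Prime.coprime_iff_not_dvd (Nat.prime_iff_prime_int.mp hp)).mpr hb)
  · rw [hu, hab]; push_cast; ring

theorem cube_eq_span_three (h : IsSimplestCubic K t θ) (hσ : Subgroup.zpowers σ = ⊤)
    (h3 : 3 ∣ t) (h27 : ¬ 27 ∣ t - 12) {P : Ideal (𝓞 K)} [hP : P.IsPrime]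
    (hpP : ((3 : ℕ) : 𝓞 K) ∈ P) :
    P ^ 3 = Ideal.span {((3 : ℕ) : 𝓞 K)} ∧ Ideal.absNorm P = 3 := by
  obtain ⟨r, rfl⟩ := h3
  by_cases hr : r % 3 = 1
  · obtain ⟨s, rfl⟩ : ∃ s, r = 3 * s + 1 := ⟨r / 3, by omega⟩
    have hs : ¬ (3 : ℤ) ∣ 2 * s + 1 := by omega
    let x : 𝓞 K := ⟨θ, h.isIntegral⟩
    have hx : x ^ 3 - ((3 * (3 * s + 1) : ℤ) : 𝓞 K) * x ^ 2 -
        (((3 * (3 * s + 1) : ℤ) : 𝓞 K) + 3) * x - 1 = 0 := by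
      apply RingOfIntegers.ext
      have := h.eq_zero
      simp only [map_sub, map_mul, map_pow, map_one, map_zero, map_add, map_intCast, map_ofNat]
      exact this
    -- Here t = 9s + 3 and `Δ_t` has 3-exponent exactly 3, so δ says nothing. Instead (θ - 1)³ is 9
    -- times an element congruent to 2s + 1 mod P, and 3 ∤ 2s + 1 is the condition t ≢ 12 mod 27.
    have hy : (x - 1) ^ 3 = (3 : ℕ) ^ 2 * (s * (x - 1) ^ 2 + (3 * s + 1) * (x - 1) + (2 * s + 1)) := by
      push_cast at hx ⊢
      linear_combination hx
    refine cube_eq_span_of_cube_eq h.finrank Nat.prime_three hpP (by norm_num) ?_ hy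
    have hmem : x - 1 ∈ P := hP.mem_of_pow_mem 3 (by
      rw [hy]; exact P.mul_mem_right _ (P.pow_mem_of_mem hpP 2 (by norm_num)))
    intro hm
    have hm' : ((2 * s + 1 : ℤ) : 𝓞 K) ∈ P := by
      have := P.sub_mem hm (P.mul_mem_right (s * (x - 1) + (3 * s + 1)) hmem)
      convert this using 1
      push_cast; ring
    exact intCast_notMem hpP ((Prime.coprime_iff_not_dvd Int.prime_three).mpr hs) hm'
  -- For r ≢ 1 mod 3, `Δ_t` = 9(r² + r + 1) has 3-exponent 2, so δ suffices.
  · refine h.cube_eq_span_of_eq hσ Nat.prime_three hpP (a := 2) (b := r ^ 2 + r + 1) ?_ ?_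
      (by norm_num)
    · rw [shanksDelta]; push_cast; ring
    · have : r % 3 = 0 ∨ r % 3 = 2 := by omega
      push_cast
      intro hd
      have hd' := Int.emod_eq_zero_of_dvd hd
      rcases this with h' | h' <;> simp [Int.add_emod, pow_two, Int.mul_emod, h'] at hd'

theorem shanksDelta_eq_of_mem {t : ℤ} {p : ℕ} (hp : p ∈ tamePrimes t) :
    ∃ (a : ℕ) (b : ℤ), shanksDelta t = p ^ a * b ∧ ¬ (p : ℤ) ∣ b ∧ ¬ 3 ∣ a := by
  rw [tamePrimes, Finset.mem_filter] at hp
  have hpp := Nat.prime_of_mem_primeFactors hp.1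
  obtain ⟨b, hb, hpb⟩ := (Nat.finiteMultiplicity_iff.mpr ⟨hpp.ne_one,
    Nat.pos_of_ne_zero (natAbs_shanksDelta_ne_zero t)⟩).exists_eq_pow_mul_and_not_dvd
  rw [Nat.multiplicity_eq_factorization hpp (natAbs_shanksDelta_ne_zero t)] at hb
  refine ⟨_, b, ?_, fun hd => hpb (by exact_mod_cast hd), hp.2.2⟩
  have h1 : shanksDelta t = ((shanksDelta t).natAbs : ℤ) :=
    (Int.natAbs_of_nonneg (shanksDelta_pos t).le).symm
  have h2 : ((shanksDelta t).natAbs : ℤ) =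
      ((p ^ (shanksDelta t).natAbs.factorization p * b : ℕ) : ℤ) := congrArg _ hb
  exact (h1.trans h2).trans (by push_cast; rfl)

theorem cube_eq_span_of_dvd (h : IsSimplestCubic K t θ) (hσ : Subgroup.zpowers σ = ⊤)
    {p : ℕ} (hp : p.Prime) (hpc : p ∣ shanksConductor t) {P : Ideal (𝓞 K)} [P.IsPrime]
    (hpP : (p : 𝓞 K) ∈ P) : P ^ 3 = Ideal.span {(p : 𝓞 K)} ∧ Ideal.absNorm P = p := by
  rw [shanksConductor, hp.dvd_mul] at hpc
  rcases hpc with hpc | hpc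
  · split_ifs at hpc with h3
    · obtain rfl : p = 3 := (Nat.prime_dvd_prime_iff_eq hp Nat.prime_three).mp
        (hp.dvd_of_dvd_pow (n := 2) (by norm_num; exact hpc))
      exact h.cube_eq_span_three hσ h3.1 h3.2 hpP
    · exact absurd (Nat.dvd_one.mp hpc) hp.ne_one
  · obtain ⟨a, b, hab, hb, ha⟩ := shanksDelta_eq_of_mem (prime_dvd_tameConductor hp hpc)
    exact h.cube_eq_span_of_eq hσ hp hpP hab hb ha

/-- Total ramification in K puts p into Q³ for a prime Q of ℚ(ζ_n) above p, whereas p ∤ n would make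
p unramified there. -/
theorem dvd_of_ringHom_cyclotomicField (h : IsSimplestCubic K t θ) (hσ : Subgroup.zpowers σ = ⊤)
    {p : ℕ} (hp : p.Prime) (hpc : p ∣ shanksConductor t) {n : ℕ} (hn : 0 < n)
    (f : K →+* CyclotomicField n ℚ) : p ∣ n := by
  by_contra hpn
  have : NeZero n := ⟨hn.ne'⟩
  have := Fact.mk hp
  set L := CyclotomicField n ℚ
  have hspan : (Ideal.span {(p : ℤ)}).IsMaximal :=
    Int.ideal_span_isMaximal_of_prime p
  obtain ⟨Q, hQmax, hQ⟩ := Ideal.exists_maximal_ideal_liesOver_of_isIntegral (S := 𝓞 L)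
    (Ideal.span {(p : ℤ)})
  have hpQ : (p : 𝓞 L) ∈ Q := by
    have : (p : ℤ) ∈ Q.comap (algebraMap ℤ (𝓞 L)) := by
      have h1 := hQ.over
      rw [Ideal.under_def] at h1
      rw [← h1]
      exact Ideal.mem_span_singleton_self _
    simpa using this
  let F : 𝓞 K →+* 𝓞 L := RingOfIntegers.mapRingHom f
  have hP := (h.cube_eq_span_of_dvd hσ hp hpc (P := Q.comap F) (by simpa using hpQ)).1
  have hmem : (p : 𝓞 L) ∈ Q ^ 3 := by
    have h1 : (p : 𝓞 K) ∈ (Q.comap F) ^ 3 := by rw [hP]; exact Ideal.mem_span_singleton_self _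
    have h2 := Ideal.mem_map_of_mem F h1
    rw [Ideal.map_pow, map_natCast] at h2
    exact Ideal.pow_right_mono Ideal.map_comap_le 3 h2
  have hmap : (Ideal.span {(p : ℤ)}).map (algebraMap ℤ (𝓞 L)) = Ideal.span {(p : 𝓞 L)} := by
    rw [Ideal.map_span, Set.image_singleton]; simp
  have hp0 : (p : 𝓞 L) ≠ 0 := Nat.cast_ne_zero.mpr hp.ne_zero
  have hbot : Ideal.span {(p : 𝓞 L)} ≠ ⊥ := by rwa [Ne, Ideal.span_singleton_eq_bot]
  have hQb : Q ≠ ⊥ := fun hb => hp0 (by rw [hb] at hpQ; exact hpQ)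
  have hr := IsCyclotomicExtension.Rat.ramificationIdx_eq_of_not_dvd (m := n) p L Q hpn
  rw [Ideal.IsDedekindDomain.ramificationIdx_eq_multiplicity (Ideal.span {(p : ℤ)}) Q
    (by rwa [hmap]), hmap] at hr
  have hfin : FiniteMultiplicity Q (Ideal.span {(p : 𝓞 L)}) :=
    FiniteMultiplicity.of_prime_left (Ideal.prime_of_isPrime hQb inferInstance) hbot
  have := hfin.pow_dvd_iff_le_multiplicity.mp (Ideal.dvd_span_singleton.mpr hmem)
  omega

theorem shanksConductor_dvd (h : IsSimplestCubic K t θ) (hσ : Subgroup.zpowers σ = ⊤)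
    {n : ℕ} (hn : 0 < n) (f : K →+* CyclotomicField n ℚ) : shanksConductor t ∣ n := by
  have htame : tameConductor t ∣ n := by
    refine Finset.prod_primes_dvd n (fun p hp => (prime_of_mem_tamePrimes hp).prime) fun p hp => ?_
    exact h.dvd_of_ringHom_cyclotomicField hσ (prime_of_mem_tamePrimes hp)
      ((Finset.dvd_prod_of_mem _ hp).mul_left _) hn f
  have hcop : Nat.Coprime 9 (tameConductor t) := by
    have := (Nat.Prime.coprime_iff_not_dvd Nat.prime_three).mpr (not_three_dvd_tameConductor t)
    exact Nat.Coprime.pow_left 2 this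
  rw [shanksConductor]
  split_ifs with h3
  · refine hcop.mul_dvd_of_dvd_of_dvd ?_ htame
    have h3c : 3 ∣ shanksConductor t := by
      rw [shanksConductor, if_pos h3]
      exact (by norm_num : 3 ∣ 9).mul_right _
    -- If 3 divided n = 3m exactly once, K would already embed in ℚ(ζ_m) with 3 ∤ m, against the
    -- ramification of 3.
    obtain ⟨m, rfl⟩ := h.dvd_of_ringHom_cyclotomicField hσ Nat.prime_three h3c hn f
    by_contra h9
    have hm : ¬ 3 ∣ m := fun ⟨k, hk⟩ => h9 ⟨k, by rw [hk]; ring⟩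
    have hm0 : 0 < m := Nat.pos_of_mul_pos_left hn
    have : NeZero m := ⟨hm0.ne'⟩
    obtain ⟨g⟩ := h.nonempty_ringHom (exists_root_cyclotomicField_of_three_mul hm
      (h.nonempty_ringHom_iff.mp ⟨f⟩))
    exact hm (h.dvd_of_ringHom_cyclotomicField hσ Nat.prime_three h3c hm0 g)
  · rwa [one_mul]

theorem fieldConductor_eq (h : IsSimplestCubic K t θ) (hσ : Subgroup.zpowers σ = ⊤) :
    fieldConductor K = shanksConductor t := by
  have hmem : shanksConductor t ∈ {n : ℕ | 0 < n ∧ Nonempty (K →+* CyclotomicField n ℚ)} :=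
    ⟨Nat.pos_of_ne_zero (shanksConductor_ne_zero t),
      h.nonempty_ringHom (exists_root_shanksConductor t)⟩
  apply le_antisymm (Nat.sInf_le hmem)
  obtain ⟨hn, ⟨f⟩⟩ := Nat.sInf_mem ⟨_, hmem⟩
  exact Nat.le_of_dvd hn (h.shanksConductor_dvd hσ hn f)

end IsSimplestCubic

end Ramification

/-! ### Cubes and the cube-free conductor -/

section Arithmetic

/-- The cube of the denominator of r is prime to the numerator, so it divides the cube-free c. -/
theorem exists_nat_eq_of_cube_mul_eq {c D : ℕ} (hc : ∀ b : ℕ, b ^ 3 ∣ c → b = 1) {r : ℚ} (hr : 0 ≤ r)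
    (h : (D : ℚ) = r ^ 3 * c) : ∃ n : ℕ, r = n := by
  have hnum : ((r.num.natAbs : ℕ) : ℚ) = r.num := by
    rw [Nat.cast_natAbs, abs_of_nonneg (Rat.num_nonneg.mpr hr)]
  have h1 : D * r.den ^ 3 = r.num.natAbs ^ 3 * c := by
    have hd : (r.den : ℚ) ≠ 0 := Nat.cast_ne_zero.mpr r.den_ne_zero
    have : (D : ℚ) * r.den ^ 3 = r.num ^ 3 * c := by
      rw [h]
      nth_rewrite 1 [← Rat.num_div_den r]
      field_simp
    rw [← hnum] at this
    exact_mod_cast this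
  have h2 : r.den ^ 3 ∣ c := by
    have hcop : Nat.Coprime (r.den ^ 3) (r.num.natAbs ^ 3) :=
      (Nat.Coprime.pow 3 3 r.reduced).symm
    exact hcop.dvd_of_dvd_mul_left (Dvd.intro_left _ h1)
  exact ⟨r.num.natAbs, by
    rw [hnum]
    nth_rewrite 1 [← Rat.num_div_den r]
    rw [hc _ h2]; simp⟩

theorem eq_one_of_cube_dvd_shanksConductor {t : ℤ} {b : ℕ} (h : b ^ 3 ∣ shanksConductor t) :
    b = 1 := by
  by_contra hb
  obtain ⟨p, hp, hpb⟩ := Nat.exists_prime_and_dvd hb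
  have hp3 : p ^ 3 ∣ shanksConductor t := (pow_dvd_pow_of_dvd hpb 3).trans h
  have hsq : Squarefree (tameConductor t) := by
    refine Finset.squarefree_prod_of_pairwise_isCoprime (fun q hq r hr hqr => ?_) fun q hq => ?_
    · exact Nat.coprime_iff_isRelPrime.mp
        ((Nat.coprime_primes (prime_of_mem_tamePrimes hq) (prime_of_mem_tamePrimes hr)).mpr hqr)
    · exact (prime_of_mem_tamePrimes hq).prime.squarefree
  have hdvd : shanksConductor t ∣ 9 * tameConductor t := by
    rw [shanksConductor]
    split_ifs
    · exact dvd_rfl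
    · exact mul_dvd_mul_right (one_dvd 9) _
  have hp9 := hp3.trans hdvd
  by_cases h3 : p = 3
  · subst h3
    refine not_three_dvd_tameConductor t (Nat.dvd_of_mul_dvd_mul_left (by norm_num : 0 < 9) ?_)
    exact hp9
  · have hcop : Nat.Coprime (p ^ 3) 9 :=
      Nat.Coprime.pow 3 2 ((Nat.coprime_primes hp Nat.prime_three).mpr h3)
    have h1 : p * p ∣ tameConductor t :=
      (Dvd.intro _ (by ring : p * p * p = p ^ 3)).trans (hcop.dvd_of_dvd_mul_left hp9)
    exact hp.one_lt.ne' (Nat.isUnit_iff.mp (hsq p h1))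

/-- Otherwise `f_t` would have a root in ℚ(ζ₁), that is, in ℚ. -/
theorem shanksConductor_ne_one (t : ℤ) : shanksConductor t ≠ 1 := fun h => by
  have hr := exists_root_shanksConductor t
  rw [h] at hr
  have hfin : Module.finrank ℚ (CyclotomicField 1 ℚ) = 1 := by
    rw [IsCyclotomicExtension.finrank (n := 1) (CyclotomicField 1 ℚ)
      (Polynomial.cyclotomic.irreducible_rat (by norm_num))]
    rfl
  obtain ⟨x, hx⟩ := exists_root_of_not_three_dvd_finrank (F := ℚ) (by rw [hfin]; norm_num) hr
  exact aeval_shanksPoly_rat_ne_zero t x hx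

/-- All exponents in a cube are divisible by 3, so no tame prime remains and the conductor is 1 or
9. -/
theorem shanksConductor_eq_nine_of_cube {t : ℤ} {n : ℕ} (h : shanksDelta t = (n : ℤ) ^ 3) :
    shanksConductor t = 9 := by
  have hempty : tamePrimes t = ∅ := by
    rw [tamePrimes, Finset.filter_eq_empty_iff]
    rintro p - ⟨-, h3⟩
    apply h3
    rw [h, Int.natAbs_pow, Int.natAbs_natCast, Nat.factorization_pow]
    exact ⟨_, rfl⟩
  have h1 := shanksConductor_ne_one t
  rw [shanksConductor, tameConductor, hempty, Finset.prod_empty, mul_one] at h1 ⊢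
  split_ifs at h1 ⊢ with h3
  · rfl
  · exact absurd rfl h1

end Arithmetic

/-! ### Ambiguous ideals with rational cube -/

section Ideals

open NumberField

variable {K : Type*} [Field K] [NumberField K]

theorem cube_eq_span_absNorm {C : Ideal (𝓞 K)} (hC : C ≠ ⊥)
    (h : ∀ P : Ideal (𝓞 K), P.IsPrime → C ≤ P → P ^ 3 = Ideal.span {((Ideal.absNorm P : ℕ) : 𝓞 K)}) :
    C ^ 3 = Ideal.span {((Ideal.absNorm C : ℕ) : 𝓞 K)} := by
  induction C using UniqueFactorizationMonoid.induction_on_prime with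
  | h₁ => exact absurd rfl hC
  | h₂ C hu =>
    rw [Ideal.isUnit_iff.mp hu, Ideal.absNorm_top, Nat.cast_one, Ideal.span_singleton_one,
      Ideal.top_pow]
  | h₃ C P hC0 hP ih =>
    rw [mul_pow, h P (Ideal.isPrime_of_prime hP) Ideal.mul_le_left,
      ih hC0 fun Q hQ hCQ => h Q hQ (Ideal.mul_le_right.trans hCQ),
      Ideal.span_singleton_mul_span_singleton, map_mul, Nat.cast_mul]

theorem IsSimplestCubic.cube_eq_span_of_absNorm_eq {t : ℤ} {θ : K} {σ : K ≃ₐ[ℚ] K}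
    (h : IsSimplestCubic K t θ) (hσ : Subgroup.zpowers σ = ⊤) {C : Ideal (𝓞 K)}
    (hC : Ideal.absNorm C = shanksConductor t) :
    C ^ 3 = Ideal.span {((shanksConductor t : ℕ) : 𝓞 K)} := by
  have hbot : C ≠ ⊥ := fun hb => by
    rw [hb, Ideal.absNorm_bot] at hC
    exact shanksConductor_ne_zero t hC.symm
  rw [← hC]
  refine cube_eq_span_absNorm hbot fun P hP hCP => ?_
  have hmem : ((shanksConductor t : ℕ) : 𝓞 K) ∈ P := hC ▸ hCP (Ideal.absNorm_mem C)
  rw [← Nat.prod_primeFactorsList (shanksConductor_ne_zero t), Nat.cast_list_prod,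
    ← Multiset.prod_coe, hP.multiset_prod_mem_iff_exists_mem] at hmem
  obtain ⟨a, ha, haP⟩ := hmem
  rw [Multiset.mem_coe] at ha
  obtain ⟨p, hp, rfl⟩ := List.mem_map.mp ha
  obtain ⟨h1, h2⟩ := h.cube_eq_span_of_dvd hσ (Nat.prime_of_mem_primeFactorsList hp)
    (Nat.dvd_of_mem_primeFactorsList hp) haP
  rw [h1, h2]

theorem ideal_cube_injective {A B : Ideal (𝓞 K)} (h : A ^ 3 = B ^ 3) : A = B :=
  pow_left_injective (by norm_num : (3 : ℕ) ≠ 0) h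

/-- Uniqueness: any such ideal has cube (c). Existence: the totally ramified primes have norm p, and
norms multiply. -/
theorem IsSimplestCubic.existsUnique_ideal {t : ℤ} {θ : K} {σ : K ≃ₐ[ℚ] K}
    (h : IsSimplestCubic K t θ) (hσ : Subgroup.zpowers σ = ⊤) :
    ∃! C : Ideal (𝓞 K), Ideal.absNorm C = fieldConductor K := by
  rw [h.fieldConductor_eq hσ]
  refine existsUnique_of_exists_of_unique ?_ fun A B hA hB => ideal_cube_injective
    ((h.cube_eq_span_of_absNorm_eq hσ hA).trans (h.cube_eq_span_of_absNorm_eq hσ hB).symm)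
  suffices ∀ n : ℕ, n ∣ shanksConductor t → ∃ C : Ideal (𝓞 K), Ideal.absNorm C = n from
    this _ dvd_rfl
  intro n
  induction n using Nat.recOnMul with
  | zero => exact fun h0 => absurd (zero_dvd_iff.mp h0) (shanksConductor_ne_zero t)
  | one => exact fun _ => ⟨⊤, Ideal.absNorm_top⟩
  | prime p hp =>
    intro hpc
    have hne : Ideal.span {(p : 𝓞 K)} ≠ ⊤ := fun ht => by
      have := absNorm_span_natCast h.finrank p
      rw [ht, Ideal.absNorm_top] at this
      exact hp.one_lt.ne' (Nat.pow_eq_one.mp this.symm |>.resolve_right (by norm_num))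
    obtain ⟨P, hP, hle⟩ := Ideal.exists_le_maximal _ hne
    exact ⟨P, (h.cube_eq_span_of_dvd hσ hp hpc (hle (Ideal.mem_span_singleton_self _))).2⟩
  | mul a b ha hb =>
    intro hab
    obtain ⟨A, hA⟩ := ha ((Dvd.intro _ rfl).trans hab)
    obtain ⟨B, hB⟩ := hb ((Dvd.intro_left _ rfl).trans hab)
    exact ⟨A * B, by rw [map_mul, hA, hB]⟩

theorem absNorm_conductorIdeal (h : ∃ C : Ideal (𝓞 K), Ideal.absNorm C = fieldConductor K) :
    Ideal.absNorm (conductorIdeal K) = fieldConductor K :=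
  Classical.epsilon_spec h

theorem galMap_coeIdeal (σ : K ≃ₐ[ℚ] K) (A : Ideal (𝓞 K)) :
    galMap σ (A : FractionalIdeal (𝓞 K)⁰ K) =
      (A.map (IsSimplestCubic.galInt σ) : Ideal (𝓞 K)) := by
  have hS := IsFractionRing.semilinearEquivOfRingEquiv_algebraMap K K (IsSimplestCubic.galInt σ)
  ext x
  constructor
  · intro hx
    obtain ⟨y, hy, rfl⟩ := hx
    obtain ⟨a, ha, rfl⟩ := (FractionalIdeal.mem_coeIdeal _).mp hy
    exact (FractionalIdeal.mem_coeIdeal _).mpr ⟨_, Ideal.mem_map_of_mem _ ha, (hS a).symm⟩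
  · intro hx
    obtain ⟨b, hb, rfl⟩ := (FractionalIdeal.mem_coeIdeal _).mp hx
    obtain ⟨a, ha, rfl⟩ := (Ideal.mem_map_iff_of_surjective _
      (IsSimplestCubic.galInt σ).surjective).mp hb
    exact ⟨algebraMap (𝓞 K) K a, (FractionalIdeal.mem_coeIdeal _).mpr ⟨a, ha, rfl⟩, hS a⟩

/-- σ fixes the cube, and cubing is injective on ideals. -/
theorem map_eq_self_of_cube_eq (σ : K ≃ₐ[ℚ] K) {A : Ideal (𝓞 K)} {n : ℤ}
    (hA : A ^ 3 = Ideal.span {(n : 𝓞 K)}) : A.map (IsSimplestCubic.galInt σ) = A := by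
  apply ideal_cube_injective
  rw [← Ideal.map_pow, hA, Ideal.map_span, Set.image_singleton, map_intCast]

theorem exists_ambiguous {A : Ideal (𝓞 K)} {n : ℤ} (hn : n ≠ 0)
    (hA : A ^ 3 = Ideal.span {(n : 𝓞 K)}) :
    ∃ a : ambiguousIdeals K,
      ((a : (FractionalIdeal (𝓞 K)⁰ K)ˣ) : FractionalIdeal (𝓞 K)⁰ K) = A := by
  have h0 : (A : FractionalIdeal (𝓞 K)⁰ K) ≠ 0 := by
    rw [FractionalIdeal.coeIdeal_ne_zero]
    rintro rfl
    rw [← Ideal.zero_eq_bot, zero_pow (by norm_num), Ideal.zero_eq_bot, eq_comm,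
      Ideal.span_singleton_eq_bot] at hA
    exact hn (by exact_mod_cast hA)
  refine ⟨⟨Units.mk0 _ h0, fun σ => Units.ext ?_⟩, rfl⟩
  change galMap σ (A : FractionalIdeal (𝓞 K)⁰ K) = A
  rw [galMap_coeIdeal, map_eq_self_of_cube_eq σ hA]

theorem mk_eq_mk_iff {a b : ambiguousIdeals K} :
    (QuotientGroup.mk a : AmbiguousClassGroup K) = QuotientGroup.mk b ↔
      ∃ q : ℚ, q ≠ 0 ∧ ((b : (FractionalIdeal (𝓞 K)⁰ K)ˣ) : FractionalIdeal (𝓞 K)⁰ K) =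
        FractionalIdeal.spanSingleton (𝓞 K)⁰ (q : K) *
          ((a : (FractionalIdeal (𝓞 K)⁰ K)ˣ) : FractionalIdeal (𝓞 K)⁰ K) := by
  rw [QuotientGroup.eq, rationalIdeals, Subgroup.mem_subgroupOf]
  constructor
  · rintro ⟨q, hq⟩
    refine ⟨q, q.ne_zero, ?_⟩
    rw [MonoidHom.comp_apply, toPrincipalIdeal_eq_iff, Subgroup.coe_mul, Subgroup.coe_inv] at hq
    have h1 : ((q : ℚ) : K) = ((Units.map (algebraMap ℚ K).toMonoidHom q : Kˣ) : K) := by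
      simp
    rw [h1, hq, Units.val_mul, mul_assoc, mul_comm _ (((a : (FractionalIdeal (𝓞 K)⁰ K)ˣ) :
      FractionalIdeal (𝓞 K)⁰ K)), ← mul_assoc, Units.inv_mul, one_mul]
  · rintro ⟨q, hq0, hq⟩
    refine ⟨Units.mk0 q hq0, ?_⟩
    rw [MonoidHom.comp_apply, toPrincipalIdeal_eq_iff, Subgroup.coe_mul, Subgroup.coe_inv,
      Units.val_mul, hq, mul_comm _ (_ * _), mul_assoc, Units.mul_inv, mul_one]
    simp

/-- The absolute norm of (a) is |a| to the power of the degree. -/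
theorem spanSingleton_rat_eq {a b : ℚ}
    (h : FractionalIdeal.spanSingleton (𝓞 K)⁰ (a : K) =
      FractionalIdeal.spanSingleton (𝓞 K)⁰ (b : K)) : |a| = |b| := by
  have h1 := congrArg FractionalIdeal.absNorm h
  have h2 (x : ℚ) : Algebra.norm ℚ (x : K) = x ^ Module.finrank ℚ K := by
    have := Algebra.norm_algebraMap (R := ℚ) (S := K) x
    simpa using this
  rw [FractionalIdeal.absNorm_span_singleton, FractionalIdeal.absNorm_span_singleton, h2, h2,
    abs_pow, abs_pow] at h1
  exact (pow_left_inj₀ (abs_nonneg _) (abs_nonneg _) Module.finrank_pos.ne').mp h1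

end Ideals

open NumberField

/-! ### The exceptional field -/

section NinthField

theorem isPrimitiveRoot_zetaNine : IsPrimitiveRoot zetaNine 9 := Complex.isPrimitiveRoot_exp 9 (by norm_num)

/-- `ζ₉ + ζ₉⁻¹` as an element of the field that it generates. -/
noncomputable def ninthGen : NinthField :=
  ⟨zetaNine + zetaNine⁻¹, IntermediateField.mem_adjoin_simple_self ℚ _⟩

theorem ninthGen_eq : ninthGen ^ 3 - 3 * ninthGen + 1 = 0 := by
  apply Subtype.ext
  change (zetaNine + zetaNine⁻¹) ^ 3 - 3 * (zetaNine + zetaNine⁻¹) + 1 = 0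
  have h9 := isPrimitiveRoot_zetaNine
  have h0 : zetaNine ≠ 0 := h9.ne_zero (by norm_num)
  have h3 : IsPrimitiveRoot (zetaNine ^ 3) 3 := h9.pow (by norm_num) (by norm_num)
  have := h3.geom_sum_eq_zero (by norm_num)
  simp [Finset.sum_range_succ] at this
  field_simp
  linear_combination this

/-- `NinthField` carries two ℚ-algebra structures, one as an intermediate field and one from
characteristic zero; this passes between them. -/
theorem adjoin_eq_top_of_algebra {L : Type*} [Field L] {S : Set L} (A B : Algebra ℚ L)
    (h : @IntermediateField.adjoin ℚ _ L _ A S = ⊤) :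
    @IntermediateField.adjoin ℚ _ L _ B S = ⊤ := by
  obtain rfl := Subsingleton.elim A B
  exact h

theorem isSimplestCubic_ninthField : IsSimplestCubic NinthField 0 (-ninthGen) := by
  refine ⟨by norm_num, ?_, ?_⟩
  · rw [aeval_shanksPoly]
    push_cast
    linear_combination -ninthGen_eq
  · refine adjoin_eq_top_of_algebra NinthField.algebra' _ ?_
    apply IntermediateField.lift_injective
    rw [IntermediateField.lift_adjoin_simple, IntermediateField.lift_top]
    apply le_antisymm
    · rw [IntermediateField.adjoin_simple_le_iff]
      exact (-ninthGen).2
    · rw [IntermediateField.adjoin_simple_le_iff]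
      have := neg_mem (IntermediateField.mem_adjoin_simple_self ℚ ((-ninthGen : NinthField) : ℂ))
      rwa [NegMemClass.coe_neg, neg_neg] at this

/-- ζ₉ is a root of x² - (ζ₉ + ζ₉⁻¹)x + 1, so passing to `NinthField` costs degree at most 2. -/
theorem exists_root_ninthField {t : ℤ}
    (h : ∃ x : CyclotomicField 9 ℚ, Polynomial.aeval x (shanksPoly t) = 0) :
    ∃ x : NinthField, Polynomial.aeval x (shanksPoly t) = 0 := by
  have h9 := isPrimitiveRoot_zetaNine
  have h0 : zetaNine ≠ 0 := h9.ne_zero (by norm_num)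
  let q : Polynomial NinthField := Polynomial.X ^ 2 + Polynomial.C (-ninthGen) * Polynomial.X + Polynomial.C 1
  have hq : q.natDegree = 2 := by
    simp only [q]; compute_degree!
  have hqm : q.Monic := by simp only [q]; monicity!
  have hqr : Polynomial.aeval zetaNine q = 0 := by
    have : algebraMap NinthField ℂ ninthGen = zetaNine + zetaNine⁻¹ := rfl
    simp only [q, map_add, map_mul, map_pow, Polynomial.aeval_X, Polynomial.aeval_C, map_neg,
      map_one, this]
    field_simp
    ring
  have hint : IsIntegral NinthField zetaNine := ⟨q, hqm, by rwa [← Polynomial.aeval_def]⟩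
  have hfin : FiniteDimensional NinthField (IntermediateField.adjoin NinthField {zetaNine}) :=
    IntermediateField.adjoin.finiteDimensional hint
  have hdeg : ¬ 3 ∣ Module.finrank NinthField (IntermediateField.adjoin NinthField {zetaNine}) := by
    rw [IntermediateField.adjoin.finrank hint]
    intro h3
    have h1 := Polynomial.natDegree_le_of_dvd (minpoly.dvd _ _ hqr) hqm.ne_zero
    have h2 := Nat.le_of_dvd (minpoly.natDegree_pos hint) h3
    omega
  refine exists_root_of_not_three_dvd_finrank hdeg ?_
  have hζ : IsPrimitiveRoot (⟨zetaNine, IntermediateField.mem_adjoin_simple_self _ _⟩ :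
      IntermediateField.adjoin NinthField {zetaNine}) 9 :=
    IsPrimitiveRoot.of_map_of_injective
      (f := algebraMap (IntermediateField.adjoin NinthField {zetaNine}) ℂ) h9
      (FaithfulSMul.algebraMap_injective _ _)
  obtain ⟨g⟩ := nonempty_cyclotomicField_algHom hζ
  obtain ⟨x, hx⟩ := h
  exact ⟨g x, map_root g.toRingHom hx⟩

theorem IsSimplestCubic.nonempty_ringEquiv_ninthField {K : Type*} [Field K] [NumberField K] {t : ℤ}
    {θ : K} (h : IsSimplestCubic K t θ) (h9 : shanksConductor t = 9) :
    Nonempty (K ≃+* NinthField) := by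
  obtain ⟨f⟩ := h.nonempty_ringHom (exists_root_ninthField (h9 ▸ exists_root_shanksConductor t))
  let g : K →ₐ[ℚ] NinthField := f.toRatAlgHom
  have hfin : Module.finrank ℚ K = Module.finrank ℚ NinthField := by
    rw [h.finrank, isSimplestCubic_ninthField.finrank]
  have hbij : Function.Bijective g :=
    ⟨g.toRingHom.injective, (LinearMap.injective_iff_surjective_of_finrank_eq_finrank hfin
      (f := g.toLinearMap)).mp g.toRingHom.injective⟩
  exact ⟨RingEquiv.ofBijective g hbij⟩

theorem exists_zpowers_eq_top_ninthField :
    ∃ σ : NinthField ≃ₐ[ℚ] NinthField, Subgroup.zpowers σ = ⊤ := by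
  have hcard := isSimplestCubic_ninthField.card_gal
  have := Fact.mk Nat.prime_three
  obtain ⟨σ, hσ⟩ := (isCyclic_of_prime_card hcard).exists_generator
  exact ⟨σ, (Subgroup.eq_top_iff' _).mpr hσ⟩

theorem shanksConductor_zero : shanksConductor 0 = 9 := by
  have hempty : tamePrimes 0 = ∅ := by
    rw [tamePrimes, Finset.filter_eq_empty_iff]
    rintro p hp ⟨hp3, -⟩
    have hpp := Nat.prime_of_mem_primeFactors hp
    have hd : p ∣ 3 ^ 2 := Nat.dvd_of_mem_primeFactors hp
    exact hp3 ((Nat.prime_dvd_prime_iff_eq hpp Nat.prime_three).mp (hpp.dvd_of_dvd_pow hd))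
  rw [shanksConductor, tameConductor, hempty]
  norm_num

/-- `ζ₉ + ζ₉⁻¹ + 1` as an algebraic integer. -/
noncomputable def ninthEta : 𝓞 NinthField :=
  1 - ⟨-ninthGen, isSimplestCubic_ninthField.isIntegral⟩

theorem coe_ninthEta : ((ninthEta : NinthField) : ℂ) = zetaNine + zetaNine⁻¹ + 1 := by
  change ((1 - -ninthGen : NinthField) : ℂ) = _
  push_cast
  change (1 : ℂ) - -(zetaNine + zetaNine⁻¹) = _
  ring

theorem absNorm_span_ninthEta_sq :
    Ideal.absNorm (Ideal.span {ninthEta} ^ 2) = fieldConductor NinthField := by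
  obtain ⟨σ, hσ⟩ := exists_zpowers_eq_top_ninthField
  rw [isSimplestCubic_ninthField.fieldConductor_eq hσ, shanksConductor_zero]
  have hη : ninthEta ^ 3 - 3 * ninthEta ^ 2 + 3 = 0 := by
    apply RingOfIntegers.ext
    change (1 - -ninthGen) ^ 3 - 3 * (1 - -ninthGen) ^ 2 + 3 = 0
    linear_combination ninthGen_eq
  -- From η³ = 3(η² - 1) with η² - 1 a unit, (η)³ = (3); so (η) has norm 3 and (η)² has norm 9.
  have hu : (ninthEta ^ 2 - 1) * (-ninthEta ^ 2 + 3 * ninthEta - 1) = 1 := by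
    linear_combination (-ninthEta) * hη
  have h3 : Ideal.span {ninthEta} ^ 3 = Ideal.span {((3 : ℕ) : 𝓞 NinthField)} := by
    rw [Ideal.span_singleton_pow, Ideal.span_singleton_eq_span_singleton]
    refine Associated.symm ⟨(IsUnit.of_mul_eq_one _ hu).unit, ?_⟩
    rw [IsUnit.unit_spec]
    push_cast
    linear_combination -hη
  have hN := congrArg Ideal.absNorm h3
  rw [absNorm_span_natCast isSimplestCubic_ninthField.finrank, map_pow] at hN
  rw [map_pow, Nat.pow_left_injective (by norm_num) hN]
  norm_num

end NinthField

/-! ### The equivalences -/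

section Main

variable {K : Type*} [Field K] [NumberField K] {t : ℤ} {θ : K} {σ : K ≃ₐ[ℚ] K}

namespace IsSimplestCubic

theorem conductorIdeal_cube (h : IsSimplestCubic K t θ) (hσ : Subgroup.zpowers σ = ⊤) :
    conductorIdeal K ^ 3 = Ideal.span {((shanksConductor t : ℤ) : 𝓞 K)} := by
  have := h.cube_eq_span_of_absNorm_eq hσ
    ((absNorm_conductorIdeal (h.existsUnique_ideal hσ).exists).trans (h.fieldConductor_eq hσ))
  rw [this, Int.cast_natCast]

theorem span_delta_cube (h : IsSimplestCubic K t θ) (hσ : Subgroup.zpowers σ = ⊤) :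
    Ideal.span {h.delta σ} ^ 3 = Ideal.span {(shanksDelta t : 𝓞 K)} := by
  obtain ⟨u, hu⟩ := h.exists_delta_cube hσ
  rw [Ideal.span_singleton_pow, hu, Ideal.span_singleton_mul_left_unit u.isUnit]

theorem coe_span_delta (h : IsSimplestCubic K t θ) :
    (Ideal.span {h.delta σ} : FractionalIdeal (𝓞 K)⁰ K) =
      FractionalIdeal.spanSingleton (𝓞 K)⁰ (θ - σ θ) := by
  rw [FractionalIdeal.coeIdeal_span_singleton]
  rfl

theorem exists_conductorIdeal_class (h : IsSimplestCubic K t θ) (hσ : Subgroup.zpowers σ = ⊤) :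
    ∃ x : AmbiguousClassGroup K,
      IsClassOf x (conductorIdeal K : FractionalIdeal (𝓞 K)⁰ K) := by
  obtain ⟨a, ha⟩ := exists_ambiguous (by exact_mod_cast shanksConductor_ne_zero t)
    (h.conductorIdeal_cube hσ)
  exact ⟨_, a, ha, rfl⟩

theorem exists_delta_class (h : IsSimplestCubic K t θ) (hσ : Subgroup.zpowers σ = ⊤) :
    ∃ y ∈ principalAmbiguousClasses K,
      IsClassOf y (FractionalIdeal.spanSingleton (𝓞 K)⁰ (θ - σ θ)) := by
  obtain ⟨a, ha⟩ := exists_ambiguous (shanksDelta_pos t).ne' (h.span_delta_cube hσ)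
  rw [h.coe_span_delta] at ha
  refine ⟨QuotientGroup.mk a, ⟨a, ?_, rfl⟩, a, ha, rfl⟩
  change (a : (FractionalIdeal (𝓞 K)⁰ K)ˣ) ∈ (toPrincipalIdeal (𝓞 K) K).range
  exact ⟨Units.mk0 (θ - σ θ) (sub_ne_zero.mpr (h.apply_ne hσ).symm),
    toPrincipalIdeal_eq_iff.mpr ha.symm⟩

/-- The condition on classes in terms of fractional ideals. -/
theorem classCondition_iff (h : IsSimplestCubic K t θ) (hσ : Subgroup.zpowers σ = ⊤) :
    ClassCondition θ σ ↔ ∃ i ∈ ({1, 2} : Set ℕ), ∃ q : ℚ, q ≠ 0 ∧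
      (conductorIdeal K : FractionalIdeal (𝓞 K)⁰ K) =
        FractionalIdeal.spanSingleton (𝓞 K)⁰ (q : K) *
          FractionalIdeal.spanSingleton (𝓞 K)⁰ (θ - σ θ) ^ i := by
  constructor
  · rintro ⟨x, y, ⟨a, ha, rfl⟩, ⟨b, hb, rfl⟩, hxy⟩
    rcases hxy with hxy | hxy
    · obtain ⟨q, hq, he⟩ := mk_eq_mk_iff.mp hxy.symm
      exact ⟨1, by simp, q, hq, by rw [pow_one, ← ha, ← hb]; exact he⟩
    · rw [← QuotientGroup.mk_pow] at hxy
      obtain ⟨q, hq, he⟩ := mk_eq_mk_iff.mp hxy.symm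
      exact ⟨2, by simp, q, hq, by rw [← ha, ← hb]; exact he⟩
  · rintro ⟨i, hi, q, hq, he⟩
    obtain ⟨x, a, ha, hx⟩ := h.exists_conductorIdeal_class hσ
    obtain ⟨y, -, b, hb, hy⟩ := h.exists_delta_class hσ
    refine ⟨x, y, ⟨a, ha, hx⟩, ⟨b, hb, hy⟩, ?_⟩
    rw [← ha, ← hb] at he
    rw [← hx, ← hy]
    rcases hi with rfl | hi
    · left
      rw [pow_one] at he
      exact (mk_eq_mk_iff.mpr ⟨q, hq, he⟩).symm
    · obtain rfl := Set.mem_singleton_iff.mp hi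
      right
      rw [← QuotientGroup.mk_pow]
      exact (mk_eq_mk_iff.mpr ⟨q, hq, he⟩).symm

theorem isPrincipal_of_classCondition (h : IsSimplestCubic K t θ) (hσ : Subgroup.zpowers σ = ⊤)
    (hc : ClassCondition θ σ) : (conductorIdeal K).IsPrincipal := by
  obtain ⟨i, -, q, -, he⟩ := (h.classCondition_iff hσ).mp hc
  rw [FractionalIdeal.spanSingleton_pow, FractionalIdeal.spanSingleton_mul_spanSingleton] at he
  obtain ⟨α, -, hα⟩ := (FractionalIdeal.mem_coeIdeal _).mp
    (he ▸ FractionalIdeal.mem_spanSingleton_self (𝓞 K)⁰ ((q : K) * (θ - σ θ) ^ i))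
  rw [← hα, ← FractionalIdeal.coeIdeal_span_singleton, FractionalIdeal.coeIdeal_inj] at he
  exact ⟨α, he⟩

theorem coe_conductorIdeal_cube (h : IsSimplestCubic K t θ) (hσ : Subgroup.zpowers σ = ⊤) :
    (conductorIdeal K : FractionalIdeal (𝓞 K)⁰ K) ^ 3 =
      FractionalIdeal.spanSingleton (𝓞 K)⁰ (((shanksConductor t : ℕ) : ℚ) : K) := by
  rw [← FractionalIdeal.coeIdeal_pow, h.conductorIdeal_cube hσ,
    FractionalIdeal.coeIdeal_span_singleton]
  simp

theorem spanSingleton_delta_cube (h : IsSimplestCubic K t θ) (hσ : Subgroup.zpowers σ = ⊤) :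
    FractionalIdeal.spanSingleton (𝓞 K)⁰ (θ - σ θ) ^ 3 =
      FractionalIdeal.spanSingleton (𝓞 K)⁰ (((shanksDelta t : ℤ) : ℚ) : K) := by
  rw [← h.coe_span_delta, ← FractionalIdeal.coeIdeal_pow, h.span_delta_cube hσ,
    FractionalIdeal.coeIdeal_span_singleton]
  simp

/-- Cubing gives (c) = (q³ `Δ_t^i`), hence `Δ_t^i / c` = |q|⁻³, and |q|⁻¹ is a natural number
because c is cube-free. -/
theorem exists_nat_of_eq_mul (h : IsSimplestCubic K t θ) (hσ : Subgroup.zpowers σ = ⊤) {i : ℕ} {q : ℚ}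
    (hq : q ≠ 0) (he : (conductorIdeal K : FractionalIdeal (𝓞 K)⁰ K) =
        FractionalIdeal.spanSingleton (𝓞 K)⁰ (q : K) *
          FractionalIdeal.spanSingleton (𝓞 K)⁰ (θ - σ θ) ^ i) :
    ∃ n : ℕ, (shanksDelta t : ℚ) ^ i / shanksConductor t = (n : ℚ) ^ 3 := by
  have h3 := congrArg (· ^ 3) he
  rw [mul_pow, ← pow_mul, mul_comm i 3, pow_mul, h.coe_conductorIdeal_cube hσ,
    h.spanSingleton_delta_cube hσ, FractionalIdeal.spanSingleton_pow,
    FractionalIdeal.spanSingleton_pow, FractionalIdeal.spanSingleton_mul_spanSingleton,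
    ← Rat.cast_pow, ← Rat.cast_pow, ← Rat.cast_mul] at h3
  have hΔ : (0 : ℚ) < shanksDelta t := by exact_mod_cast shanksDelta_pos t
  have habs := spanSingleton_rat_eq h3
  rw [abs_of_nonneg (Nat.cast_nonneg _), abs_mul, abs_pow,
    abs_of_pos (pow_pos hΔ i)] at habs
  have hq' : |q| ≠ 0 := abs_ne_zero.mpr hq
  have hD : ((((shanksDelta t).natAbs ^ i : ℕ) : ℕ) : ℚ) = |q|⁻¹ ^ 3 * shanksConductor t := by
    rw [habs]
    push_cast
    rw [Nat.cast_natAbs, abs_of_pos (shanksDelta_pos t)]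
    field_simp
  obtain ⟨n, hn⟩ := exists_nat_eq_of_cube_mul_eq
    (fun b => eq_one_of_cube_dvd_shanksConductor) (inv_nonneg.mpr (abs_nonneg q)) hD
  refine ⟨n, ?_⟩
  rw [← hn, habs]
  field_simp

theorem eq_mul_of_div_eq_cube (h : IsSimplestCubic K t θ) (hσ : Subgroup.zpowers σ = ⊤) {i n : ℕ}
    (hn : (shanksDelta t : ℚ) ^ i / shanksConductor t = (n : ℚ) ^ 3) :
    ∃ q : ℚ, q ≠ 0 ∧ (conductorIdeal K : FractionalIdeal (𝓞 K)⁰ K) =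
        FractionalIdeal.spanSingleton (𝓞 K)⁰ (q : K) *
          FractionalIdeal.spanSingleton (𝓞 K)⁰ (θ - σ θ) ^ i := by
  have hc0 : (shanksConductor t : ℚ) ≠ 0 := Nat.cast_ne_zero.mpr (shanksConductor_ne_zero t)
  have hΔ : (shanksDelta t : ℚ) ≠ 0 := by exact_mod_cast (shanksDelta_pos t).ne'
  have hn0 : (n : ℚ) ≠ 0 := fun h0 => by
    rw [h0, zero_pow (by norm_num)] at hn
    exact div_ne_zero (pow_ne_zero i hΔ) hc0 hn
  have hmul : shanksDelta t ^ i = (n : ℤ) ^ 3 * shanksConductor t := by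
    rw [div_eq_iff hc0] at hn
    exact_mod_cast hn
  -- Both sides have the same cube.
  have hI : Ideal.span {h.delta σ} ^ i = Ideal.span {(n : 𝓞 K)} * conductorIdeal K := by
    apply ideal_cube_injective
    rw [← pow_mul, mul_comm, pow_mul, h.span_delta_cube hσ, mul_pow, h.conductorIdeal_cube hσ,
      Ideal.span_singleton_pow, Ideal.span_singleton_pow, Ideal.span_singleton_mul_span_singleton]
    congr 2
    exact_mod_cast congrArg (Int.cast : ℤ → 𝓞 K) hmul
  refine ⟨(n : ℚ)⁻¹, inv_ne_zero hn0, ?_⟩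
  rw [← h.coe_span_delta, ← FractionalIdeal.coeIdeal_pow, hI, FractionalIdeal.coeIdeal_mul,
    FractionalIdeal.coeIdeal_span_singleton, ← mul_assoc,
    FractionalIdeal.spanSingleton_mul_spanSingleton]
  have : (((n : ℚ)⁻¹ : ℚ) : K) * algebraMap (𝓞 K) K n = 1 := by
    have hnK : (n : K) ≠ 0 := by exact_mod_cast hn0
    simp [hnK]
  rw [this, FractionalIdeal.spanSingleton_one, one_mul]

theorem classCondition_iff_cubeCondition (h : IsSimplestCubic K t θ)
    (hσ : Subgroup.zpowers σ = ⊤) : ClassCondition θ σ ↔ CubeCondition K t := by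
  rw [h.classCondition_iff hσ, CubeCondition, h.fieldConductor_eq hσ]
  constructor
  · rintro ⟨i, hi, q, hq, he⟩
    have := h.exists_nat_of_eq_mul hσ hq he
    rcases hi with rfl | hi
    · left
      simpa only [pow_one] using this
    · obtain rfl := Set.mem_singleton_iff.mp hi
      exact .inr this
  · rintro (⟨n, hn⟩ | ⟨n, hn⟩)
    · exact ⟨1, by simp, h.eq_mul_of_div_eq_cube hσ (by rw [pow_one]; exact hn)⟩
    · exact ⟨2, by simp, h.eq_mul_of_div_eq_cube hσ hn⟩

/-- Otherwise (δ) = (q), so `Δ_t` = |q|³ is the cube of an integer and the conductor is 9, which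
only the excluded field has. -/
theorem delta_ne_rat_mul_unit (h : IsSimplestCubic K t θ) (hσ : Subgroup.zpowers σ = ⊤)
    (h9 : IsEmpty (K ≃+* NinthField)) (q : ℚ) (e : (𝓞 K)ˣ) :
    (h.delta σ : K) ≠ q * (e : 𝓞 K) := fun hd => by
  have hspan : FractionalIdeal.spanSingleton (𝓞 K)⁰ (θ - σ θ) =
      FractionalIdeal.spanSingleton (𝓞 K)⁰ (q : K) := by
    rw [← h.coe_delta, hd, ← FractionalIdeal.spanSingleton_mul_spanSingleton,
      ← FractionalIdeal.coeIdeal_span_singleton, Ideal.span_singleton_eq_top.mpr e.isUnit,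
      FractionalIdeal.coeIdeal_top, mul_one]
  have h3 := h.spanSingleton_delta_cube hσ
  rw [hspan, FractionalIdeal.spanSingleton_pow, ← Rat.cast_pow] at h3
  have habs := spanSingleton_rat_eq h3
  rw [abs_pow] at habs
  obtain ⟨n, hn⟩ := exists_nat_eq_of_cube_mul_eq (c := 1) (D := (shanksDelta t).natAbs) (r := |q|)
    (fun b hb => by simpa using hb) (abs_nonneg q) (by
      rw [habs, Nat.cast_natAbs]; simp)
  refine h9.false (h.nonempty_ringEquiv_ninthField (shanksConductor_eq_nine_of_cube (n := n) ?_)).some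
  rw [hn, abs_of_pos (by exact_mod_cast shanksDelta_pos t : (0 : ℚ) < shanksDelta t)] at habs
  exact_mod_cast habs.symm

theorem classCondition_of_isPrincipal (h : IsSimplestCubic K t θ) (hσ : Subgroup.zpowers σ = ⊤)
    (h9 : IsEmpty (K ≃+* NinthField)) (hC : (conductorIdeal K).IsPrincipal) :
    ClassCondition θ σ := by
  obtain ⟨α, hα⟩ := hC
  change conductorIdeal K = Ideal.span {α} at hα
  have hcube := h.conductorIdeal_cube hσ
  have hα0 : α ≠ 0 := fun h0 => by
    rw [hα, h0, Ideal.span_singleton_pow, zero_pow (by norm_num), eq_comm,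
      Ideal.span_singleton_eq_span_singleton, associated_zero_iff_eq_zero] at hcube
    exact shanksConductor_ne_zero t (by exact_mod_cast hcube)
  have hmap := map_eq_self_of_cube_eq σ hcube
  rw [hα, Ideal.map_span, Set.image_singleton, Ideal.span_singleton_eq_span_singleton] at hmap
  obtain ⟨w, hw⟩ := hmap.symm
  obtain ⟨i, hi, q, e, he⟩ := h.exists_eq_mul_delta_pow hσ
    (h.delta_ne_rat_mul_unit hσ h9) hα0 (w := w) (by rw [← hw, mul_comm])
  have hspan : (conductorIdeal K : FractionalIdeal (𝓞 K)⁰ K) =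
      FractionalIdeal.spanSingleton (𝓞 K)⁰ (q : K) *
        FractionalIdeal.spanSingleton (𝓞 K)⁰ (θ - σ θ) ^ i := by
    rw [hα, FractionalIdeal.coeIdeal_span_singleton]
    change FractionalIdeal.spanSingleton (𝓞 K)⁰ (α : K) = _
    rw [he, ← FractionalIdeal.spanSingleton_mul_spanSingleton,
      ← FractionalIdeal.spanSingleton_mul_spanSingleton,
      ← FractionalIdeal.coeIdeal_span_singleton, Ideal.span_singleton_eq_top.mpr e.isUnit,
      FractionalIdeal.coeIdeal_top, mul_one, FractionalIdeal.spanSingleton_pow, h.coe_delta]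
  have hq : q ≠ 0 := fun h0 => by
    rw [h0, Rat.cast_zero, zero_mul, zero_mul, RingOfIntegers.coe_eq_zero_iff] at he
    exact hα0 he
  refine (h.classCondition_iff hσ).mpr ⟨i, ?_, q, hq, hspan⟩
  -- For i = 0 the conductor would be the inverse of a cube n³, hence 1.
  have hi0 : i ≠ 0 := fun h0 => by
    obtain ⟨n, hn⟩ := h.exists_nat_of_eq_mul hσ hq hspan
    rw [h0, pow_zero, div_eq_iff (Nat.cast_ne_zero.mpr (shanksConductor_ne_zero t))] at hn
    have : n ^ 3 * shanksConductor t = 1 := by exact_mod_cast hn.symm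
    exact shanksConductor_ne_one t (Nat.eq_one_of_mul_eq_one_left this)
  simp only [Set.mem_insert_iff, Set.mem_singleton_iff]
  omega

theorem tfae (h : IsSimplestCubic K t θ) (hσ : Subgroup.zpowers σ = ⊤)
    (h9 : IsEmpty (K ≃+* NinthField)) :
    List.TFAE [(conductorIdeal K).IsPrincipal, ClassCondition θ σ, CubeCondition K t] := by
  tfae_have 1 → 2 := h.classCondition_of_isPrincipal hσ h9
  tfae_have 2 → 1 := h.isPrincipal_of_classCondition hσ
  tfae_have 2 ↔ 3 := h.classCondition_iff_cubeCondition hσ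
  tfae_finish

end IsSimplestCubic

end Main

end SimplestCubic

theorem theorem3 :
    (∀ (K : Type*) [Field K] [NumberField K] (t : ℤ) (θ : K) (σ : K ≃ₐ[ℚ] K),
      IsSimplestCubic K t θ → Subgroup.zpowers σ = ⊤ →
        -- the objects in the equivalence are well defined
        (∃! C : Ideal (𝓞 K), Ideal.absNorm C = fieldConductor K) ∧
        (∃ x : AmbiguousClassGroup K,
          IsClassOf x (conductorIdeal K : FractionalIdeal (𝓞 K)⁰ K)) ∧
        (∃ y ∈ principalAmbiguousClasses K,
          IsClassOf y (FractionalIdeal.spanSingleton (𝓞 K)⁰ (θ - σ θ))) ∧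
        (IsEmpty (K ≃+* NinthField) →
          -- the equivalence
          List.TFAE [
            (conductorIdeal K).IsPrincipal,
            ClassCondition θ σ,
            CubeCondition K t] ∧
          -- independence of the choice of `t`, `θ`, `σ`
          (∀ (t' : ℤ) (θ' : K) (σ' : K ≃ₐ[ℚ] K),
            IsSimplestCubic K t' θ' → Subgroup.zpowers σ' = ⊤ →
            ((ClassCondition θ σ ↔ ClassCondition θ' σ') ∧
              (CubeCondition K t ↔ CubeCondition K t'))))) ∧
    -- the exceptional field
    ((∃! C : Ideal (𝓞 NinthField), Ideal.absNorm C = fieldConductor NinthField) ∧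
      (conductorIdeal NinthField).IsPrincipal ∧
      ∃ η : 𝓞 NinthField,
        ((η : NinthField) : ℂ) = zetaNine + zetaNine⁻¹ + 1 ∧
        conductorIdeal NinthField = Ideal.span {η} ^ 2) := by
  refine ⟨fun K _ _ t θ σ h hσ => ⟨h.existsUnique_ideal hσ, h.exists_conductorIdeal_class hσ,
    h.exists_delta_class hσ, fun h9 => ⟨h.tfae hσ h9, fun t' θ' σ' h' hσ' => ?_⟩⟩, ?_⟩
  -- Independence: both conditions are equivalent to ℭ being principal, which does not mention t, θ
  -- or σ.
  · exact ⟨((h.tfae hσ h9).out 1 0).trans ((h'.tfae hσ' h9).out 0 1),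
      ((h.tfae hσ h9).out 2 0).trans ((h'.tfae hσ' h9).out 0 2)⟩
  · obtain ⟨σ, hσ⟩ := exists_zpowers_eq_top_ninthField
    have hex := isSimplestCubic_ninthField.existsUnique_ideal hσ
    have heq : conductorIdeal NinthField = Ideal.span {ninthEta} ^ 2 :=
      hex.unique (absNorm_conductorIdeal hex.exists) absNorm_span_ninthEta_sq
    refine ⟨hex, ⟨ninthEta ^ 2, ?_⟩, ninthEta, coe_ninthEta, heq⟩
    rw [heq, Ideal.span_singleton_pow]
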